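/- **Ordinals.** Let $\Omega=\omega_1$. For ordinals $\alpha,\beta$ define, by recursion on $\alpha$, $C(\alpha,\beta)$ as the least set containing $\{0,\Omega\}\cup\beta$ that is closed under $+$, under $\xi\mapsto\omega^\xi$, and under $\xi\mapsto\psi(\xi)$ for $\xi<\alpha$; and $\psi(\alpha):=\min\{\eta : C(\alpha,\eta)\cap\Omega=\eta\}$. Let $\varepsilon_{\Omega+1}$ be the least $\alpha>\Omega$ with $\omega^\alpha=\alpha$. A *level* is an ordinal below $\Omega$ in $C(\varepsilon_{\Omega+1},0)$. For a set $X$ of ordinals put $\mathcal H_\sigma(X):=\bigcap\{C(\alpha,\beta) : X\subseteq C(\alpha,\beta),\ \sigma<\alpha\}$. For an operator $\mathcal H$ on sets of ordinals and a set $\mathfrak m$ of ordinals, $\mathcal H[\mathfrak m](X):=\mathcal H(\mathfrak m\cup X)$; $\mathcal H[\beta]:=\mathcal H[\{\beta\}]$. **Language.** Set terms $a,b$ are set variables and the constants $\underline\varnothing,\underline\omega$; there are unary relation variables $U$. Formulas (in negation normal form, up to renaming of bound variables) are built from $a\in b$, $a\notin b$, $U(a)$, $\neg U(a)$, $M_\alpha(a)$,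 $\neg M_\alpha(a)$ by $\lor,\land$, bounded quantifiers $(Qx\in a)$, quantifiers $Qx^\alpha$, unbounded set quantifiers $Qx$, and relation quantifiers $QX$ ($\alpha$ a level, $Q\in\{\exists,\forall\}$). $\neg F$ is defined by de Morgan's laws; $F\to G$ is $\neg F\lor G$, $F\leftrightarrow G$ is $(F\to G)\land(G\to F)$, and $a=b$ is $(\forall x\in a)(x\in b)\land(\forall x\in b)(x\in a)$. $\mathit{FinOrd}[a]$ is the usual formula with only bounded quantifiers saying that $a$ is an ordinal (transitive, with transitive elements), and that $a$ and each of its elements is empty or a successor ordinal. $\Delta_0$ formulas contain no $M_\alpha$, no $Qx^\alpha$, no $Qx$, no $QX$. $\Sigma$ formulas: the closure of $\Delta_0$ under $\lor,\land$, bounded quantifiers, $\exists x$. $\mathcal D$: the formulas without $Qx$ and $QX$. $\mathcal S$: the closure of $\mathcal D$ under $\lor,\land$, $Qx^\alpha$, bounded quantifiers, $\exists x$. $\mathcal S_0$: the $\Sigma$ formulas that are not $\Delta_0$. $\mathcal B$: the formulas without $Qx$. $F^{(a)}$ replaces every $Qx$ in $F$ by $(Qx\in a)$; for $F\in\mathcal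 S$, $F^\beta$ replaces every $\exists x$ in $F$ by $\exists x^\beta$. *Rank:* $0$ for $(\neg)\,a\in b$, $(\neg)\,U(a)$; $\omega\alpha$ for $(\neg)M_\alpha(a)$; $\mathrm{rk}(F\lor G)=\mathrm{rk}(F\land G)=\max(\mathrm{rk}F,\mathrm{rk}G)+1$; $\mathrm{rk}((Qx\in a)F)=\mathrm{rk}(F)+2$; $\mathrm{rk}(Qx^\alpha F)=\max(\omega\alpha,\mathrm{rk}F)+2$; $\mathrm{rk}(QxF)=\Omega$ if $F$ is $\Delta_0$, and $\max(\Omega+1,\mathrm{rk}(F)+3)$ otherwise; $\mathrm{rk}(QXF)=\mathrm{rk}(F)+1$. *Parameters:* $|F|$ is the set of all $\alpha$ such that $M_\alpha$ or $Qx^\alpha$ occurs in $F$, together with $0$ if $F$ contains an atom $(\neg)\,a\in b$ or $(\neg)\,U(a)$ or a bounded quantifier; $|\Gamma|:=\bigcup_{F\in\Gamma}|F|$, and $\mathcal H[\Gamma]:=\mathcal H[|\Gamma|]$. *Length:* $\ell(F)=0$ for atomic and negated atomic $F$, $\ell(F\lor G)=\ell(F\land G)=\max(\ell(F),\ell(G))+1$,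 and every quantifier adds $1$. **Axioms of $\mathsf{RS}^*$** ($\Gamma$ a finite set of formulas; $a,b$ set terms; $\alpha,\beta$ levels): (1) $\Gamma,\neg F,F$ for $F\in\mathcal B$; (2) $\Gamma,a\ne b,\neg F[a],F[b]$ for $F[u]\in\mathcal B$; (3) $\Gamma,\neg U(a),a\in\underline\omega$; (4) $\Gamma,\neg M_0(a)$; (5) $\Gamma,M_1(\underline\varnothing)$; (6) $\Gamma,a\notin\underline\varnothing$; (7) $\Gamma,M_{\omega+1}(\underline\omega)$; (8) $\Gamma,a\in\underline\omega\leftrightarrow\mathit{FinOrd}[a]$; (9) $\Gamma,\neg M_\alpha(a),M_\beta(a)$ for $\alpha\le\beta$; (10) $\Gamma,\neg M_{\alpha+1}(a),b\notin a,M_\alpha(b)$; (11) $\Gamma,\neg M_\alpha(a),\neg M_\beta(b),\exists z^{\beta+1}(a\in z\land b\in z)$ for $\alpha\le\beta$; (12) $\Gamma,\neg M_\alpha(a),\exists z^\alpha(\forall y\in a)(\forall x\in y)(x\in z)$; (13) $\Gamma,\neg M_\alpha(a),\exists z^{\alpha+1}(z=\{x\in a:A[x]\})$ for $A[u]$ in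 $\Delta_0$; (14) $\Gamma,\exists Z(\forall x\in\underline\omega)(Z(x)\leftrightarrow\forall Y A[x,Y])$ for $A[u,V]$ in $\Delta_0$. **Derivations.** $\mathcal H\vdash^\alpha_\rho\Theta$ ("$\Theta$ has an $\mathcal H$-controlled derivation of depth $\alpha$ and cut rank $\rho$") is defined by recursion on $\alpha$: it holds iff $\{\alpha\}\cup|\Theta|\subseteq\mathcal H(\varnothing)$ and either $\Theta$ is an axiom or $\Theta$ is the conclusion of one of the following rules whose premises are derivable as stated ($\beta,\tau,\lambda$ range over levels, $a,b$ over set terms, $U$ over relation variables; unless shown otherwise the operator is $\mathcal H$; the cut rank is always $\rho$; depths satisfy $\alpha_0,\alpha_1,\alpha_\beta<\alpha$): - $(\lor)$ from $\vdash^{\alpha_0}\Gamma,F,G$ infer $\Gamma,F\lor G$; $(\land)$ from $\vdash^{\alpha_0}\Gamma,F$ and $\vdash^{\alpha_1}\Gamma,G$ infer $\Gamma,F\land G$; - $(\neg M)$ from $\mathcal H[\beta]\vdash^{\alpha_\beta}\Gamma,\neg M_\beta(a)$ for all $\beta<\lambda$ infer $\Gamma,\neg M_\lambda(a)$, for $\lambda$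 a limit; - $(\exists)$ from $\vdash^{\alpha_0}\Gamma,M_\beta(a)\land F[a]$ with $\beta<\alpha$ infer $\Gamma,\exists xF[x]$; - $(\forall)$ from $\mathcal H[\beta]\vdash^{\alpha_\beta}\Gamma,\neg M_\beta(a)\lor F[a]$ for all $\beta$ and all $a$, with $\beta<\alpha_\beta$, infer $\Gamma,\forall xF[x]$; - $(\exists^\tau)$ from $\vdash^{\alpha_0}\Gamma,M_\beta(a)\land F[a]$ with $\beta\le\tau$ infer $\Gamma,\exists x^\tau F[x]$; - $(\forall^\tau)$ from $\mathcal H[\beta]\vdash^{\alpha_\beta}\Gamma,\neg M_\beta(a)\lor F[a]$ for all $\beta\le\tau$ and all $a$ infer $\Gamma,\forall x^\tau F[x]$; - $(b\exists)$ from $\vdash^{\alpha_0}\Gamma,b\in a\land F[b]$ infer $\Gamma,(\exists x\in a)F[x]$; $(b\forall)$ from $\vdash^{\alpha_0}\Gamma,b\notin a\lor F[b]$ for all $b$ infer $\Gamma,(\forall x\in a)F[x]$; - $(\exists_2)$ from $\vdash^{\alpha_0}\Gamma,F[U]$ infer $\Gamma,\exists XF[X]$; $(\forall_2)$ from $\vdash^{\alpha_0}\Gamma,F[U]$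 for all $U$ infer $\Gamma,\forall XF[X]$; - $(\mathsf{Cut})$ from $\vdash^{\alpha_0}\Gamma,F$ and $\vdash^{\alpha_0}\Gamma,\neg F$ with $\mathrm{rk}(F)<\rho$ infer $\Gamma$; - $(\mathcal S_0\text{-}\mathsf{Ref})$ from $\vdash^{\alpha_0}\Gamma,F$ with $F\in\mathcal S_0$ and $\Omega<\alpha$ infer $\Gamma,\exists zF^{(z)}$; - $(\mathsf{BC})$ from $\vdash^{\alpha_0}\Gamma,F^\beta$ with $F\in\mathcal S_0$ infer $\Gamma,\exists z^{\beta+\omega}F^{(z)}$. For $p<\omega$, $\mathcal H\vdash^\alpha_{\rho,p}\Theta$ is defined in the same way, with the additional requirements, at every step of the derivation, that $\ell(F)<p$ for all $F\in\Theta$ and, if the step is a cut with cut formulas $G,\neg G$, that $\ell(G)<p$. **Theorem.** Let $\Gamma$ be a finite set of formulas from $\mathcal S\cup\mathcal B$ and $\sigma$ an ordinal such that $$|\Gamma|\subseteq C(\sigma+1,\psi(\sigma+1))\quad\text{and}\quad \sigma\in\mathcal H_\sigma[\Gamma](\varnothing).$$ For every ordinal $\alpha$ put $\widehat\alpha:=\sigma+\omega^{\Omega+\alpha}$.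 Then: 1. (Collapsing) for all $\alpha$: if $\mathcal H_\sigma[\Gamma]\vdash^{\alpha}_{\Omega+1}\Gamma$, then $\mathcal H_{\widehat\alpha}[\Gamma]\vdash^{\psi(\widehat\alpha)}_{\psi(\widehat\alpha)}\Gamma$; 2. (Refined collapsing) for all $\alpha$ and all $p<\omega$: if $\mathcal H_\sigma[\Gamma]\vdash^{\alpha}_{\Omega+1,\,p}\Gamma$, then $\mathcal H_{\widehat\alpha}[\Gamma]\vdash^{\psi(\widehat\alpha)}_{\psi(\widehat\alpha),\,p}\Gamma$. -/

import Mathlib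

open Ordinal Set

noncomputable section

namespace RSStar

/-! ## Ordinals: the sets `C(α, β)`, the collapsing function `ψ` -/

/-- `Ω`, the first uncountable ordinal. -/
def Om : Ordinal.{0} := ω_ 1

/-- One stage of the simultaneous recursion: the closure of `{0, Ω} ∪ β` under `+`, `ξ ↦ ω ^ ξ`
and `ξ ↦ f ξ` for `ξ < α`, where `f` stands for the values of `ψ` below `α`. -/
inductive Closure (α : Ordinal.{0}) (f : (ξ : Ordinal.{0}) → ξ < α → Ordinal.{0})
    (β : Ordinal.{0}) : Ordinal.{0} → Prop
  | zero : Closure α f β 0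
  | omega : Closure α f β Om
  | base {ξ : Ordinal.{0}} (h : ξ < β) : Closure α f β ξ
  | add {η ξ : Ordinal.{0}} : Closure α f β η → Closure α f β ξ → Closure α f β (η + ξ)
  | opow {ξ : Ordinal.{0}} : Closure α f β ξ → Closure α f β (ω ^ ξ)
  | collapse {ξ : Ordinal.{0}} (h : ξ < α) : Closure α f β ξ → Closure α f β (f ξ h)

/-- `ψ(α)`, the least `η` with `C(α, η) ∩ Ω = η`. -/
def psi (α : Ordinal.{0}) : Ordinal.{0} :=
  sInf {η | {ξ | Closure α (fun ζ _ => psi ζ) η ξ} ∩ Iio Om = Iio η}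
termination_by α

/-- The set of ordinals `C(α, β)`. -/
def C (α β : Ordinal.{0}) : Set Ordinal.{0} :=
  {ξ | Closure α (fun ζ _ => psi ζ) β ξ}

theorem psi_eq (α : Ordinal.{0}) : psi α = sInf {η | C α η ∩ Iio Om = Iio η} := by
  rw [psi]; rfl

/-- `ε_{Ω+1}`, the least `α > Ω` with `ω ^ α = α`. -/
def epsOm : Ordinal.{0} := sInf {α | Om < α ∧ ω ^ α = α}

/-- The ordinals below `Ω` of the notation system `C(ε_{Ω+1}, 0)`. They index the relation symbols
`M_α` and the quantifiers `Q x^α`. -/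
abbrev Level : Type 1 := {α : Ordinal.{0} // α < Om ∧ α ∈ C epsOm 0}

def Level.add (α β : Level) : Level :=
  ⟨α.1 + β.1, isPrincipal_add_omega 1 α.2.1 β.2.1, Closure.add α.2.2 β.2.2⟩

def Level.zero : Level := ⟨0, omega_pos 1, Closure.zero⟩

def Level.one : Level :=
  ⟨1, one_lt_omega0.trans omega0_lt_omega_one, by
    have h := Closure.opow (α := epsOm) (f := fun ζ _ => psi ζ) (β := 0) Closure.zero
    rwa [opow_zero] at h⟩

def Level.omega : Level :=
  ⟨ω, omega0_lt_omega_one, by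
    have h := Closure.opow (α := epsOm) (f := fun ζ _ => psi ζ) (β := 0) Level.one.2.2
    rwa [show Level.one.1 = 1 from rfl, opow_one] at h⟩

/-! ## The language

Formulas are taken up to renaming of bound variables: free set and relation variables are numbered
by `ℕ`, bound ones are de Bruijn indices. `Fml n m` has `n` dangling bound set variables and `m`
dangling bound relation variables, so the formulas of the language are the elements of `Fml 0 0`,
its set terms those of `Term 0`, and a formula `F[u]` with a designated set variable is an element
`F` of `Fml (n + 1) m`. -/

/-- Set terms: the two constants and the set variables. -/
inductive Term (n : ℕ) : Type
  | empty : Term n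
  | omega : Term n
  | free (u : ℕ) : Term n
  | bound (i : Fin n) : Term n

/-- Relation variables. -/
inductive RVar (m : ℕ) : Type
  | free (U : ℕ) : RVar m
  | bound (i : Fin m) : RVar m

/-- Formulas, in negation normal form. -/
inductive Fml : ℕ → ℕ → Type 1
  | mem {n m : ℕ} (a b : Term n) : Fml n m
  | nmem {n m : ℕ} (a b : Term n) : Fml n m
  | rel {n m : ℕ} (U : RVar m) (a : Term n) : Fml n m
  | nrel {n m : ℕ} (U : RVar m) (a : Term n) : Fml n m
  | lev {n m : ℕ} (α : Level) (a : Term n) : Fml n m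
  | nlev {n m : ℕ} (α : Level) (a : Term n) : Fml n m
  | or {n m : ℕ} (F G : Fml n m) : Fml n m
  | and {n m : ℕ} (F G : Fml n m) : Fml n m
  | bex {n m : ℕ} (a : Term n) (F : Fml (n + 1) m) : Fml n m
  | ball {n m : ℕ} (a : Term n) (F : Fml (n + 1) m) : Fml n m
  | exL {n m : ℕ} (α : Level) (F : Fml (n + 1) m) : Fml n m
  | allL {n m : ℕ} (α : Level) (F : Fml (n + 1) m) : Fml n m
  | ex {n m : ℕ} (F : Fml (n + 1) m) : Fml n m
  | all {n m : ℕ} (F : Fml (n + 1) m) : Fml n m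
  | exR {n m : ℕ} (F : Fml n (m + 1)) : Fml n m
  | allR {n m : ℕ} (F : Fml n (m + 1)) : Fml n m

instance {n m : ℕ} : DecidableEq (Fml n m) := Classical.decEq _

/-! ### Substitution -/

def Term.subst {n k : ℕ} (s : Fin n → Term k) : Term n → Term k
  | .empty => .empty
  | .omega => .omega
  | .free u => .free u
  | .bound i => s i

/-- Weakening past one new set quantifier. -/
def Term.wk {n : ℕ} (a : Term n) : Term (n + 1) := a.subst fun i => .bound i.succ

def RVar.subst {m k : ℕ} (s : Fin m → RVar k) : RVar m → RVar k
  | .free U => .free U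
  | .bound i => s i

/-- Weakening past one new relation quantifier. -/
def RVar.wk {m : ℕ} (U : RVar m) : RVar (m + 1) := U.subst fun i => .bound i.succ

/-- Extending a substitution under a set quantifier. -/
def liftT {n k : ℕ} (s : Fin n → Term k) : Fin (n + 1) → Term (k + 1) :=
  Fin.cases (.bound 0) fun i => (s i).wk

/-- Extending a substitution under a relation quantifier. -/
def liftR {m k : ℕ} (s : Fin m → RVar k) : Fin (m + 1) → RVar (k + 1) :=
  Fin.cases (.bound 0) fun i => (s i).wk

/-- Simultaneous substitution of set terms for the dangling set variables. -/
def Fml.subst : {n m : ℕ} → Fml n m → {k : ℕ} → (Fin n → Term k) → Fml k m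
  | _, _, .mem a b, _, s => .mem (a.subst s) (b.subst s)
  | _, _, .nmem a b, _, s => .nmem (a.subst s) (b.subst s)
  | _, _, .rel U a, _, s => .rel U (a.subst s)
  | _, _, .nrel U a, _, s => .nrel U (a.subst s)
  | _, _, .lev α a, _, s => .lev α (a.subst s)
  | _, _, .nlev α a, _, s => .nlev α (a.subst s)
  | _, _, .or F G, _, s => .or (F.subst s) (G.subst s)
  | _, _, .and F G, _, s => .and (F.subst s) (G.subst s)
  | _, _, .bex a F, _, s => .bex (a.subst s) (F.subst (liftT s))
  | _, _, .ball a F, _, s => .ball (a.subst s) (F.subst (liftT s))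
  | _, _, .exL α F, _, s => .exL α (F.subst (liftT s))
  | _, _, .allL α F, _, s => .allL α (F.subst (liftT s))
  | _, _, .ex F, _, s => .ex (F.subst (liftT s))
  | _, _, .all F, _, s => .all (F.subst (liftT s))
  | _, _, .exR F, _, s => .exR (F.subst s)
  | _, _, .allR F, _, s => .allR (F.subst s)

/-- Simultaneous substitution of relation variables for the dangling relation variables. -/
def Fml.substR : {n m : ℕ} → Fml n m → {k : ℕ} → (Fin m → RVar k) → Fml n k
  | _, _, .mem a b, _, _ => .mem a b
  | _, _, .nmem a b, _, _ => .nmem a b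
  | _, _, .rel U a, _, s => .rel (U.subst s) a
  | _, _, .nrel U a, _, s => .nrel (U.subst s) a
  | _, _, .lev α a, _, _ => .lev α a
  | _, _, .nlev α a, _, _ => .nlev α a
  | _, _, .or F G, _, s => .or (F.substR s) (G.substR s)
  | _, _, .and F G, _, s => .and (F.substR s) (G.substR s)
  | _, _, .bex a F, _, s => .bex a (F.substR s)
  | _, _, .ball a F, _, s => .ball a (F.substR s)
  | _, _, .exL α F, _, s => .exL α (F.substR s)
  | _, _, .allL α F, _, s => .allL α (F.substR s)
  | _, _, .ex F, _, s => .ex (F.substR s)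
  | _, _, .all F, _, s => .all (F.substR s)
  | _, _, .exR F, _, s => .exR (F.substR (liftR s))
  | _, _, .allR F, _, s => .allR (F.substR (liftR s))

/-- `F[a]` for `F[u]`. -/
def Fml.inst {n m : ℕ} (F : Fml (n + 1) m) (a : Term n) : Fml n m :=
  F.subst (Fin.cases a Term.bound)

/-- `F[V]` for `F[U]`. -/
def Fml.instR {n m : ℕ} (F : Fml n (m + 1)) (V : RVar m) : Fml n m :=
  F.substR (Fin.cases V RVar.bound)

def Fml.wk {n m : ℕ} (F : Fml n m) : Fml (n + 1) m := F.subst fun i => .bound i.succ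

def Fml.wkR {n m : ℕ} (F : Fml n m) : Fml n (m + 1) := F.substR fun i => .bound i.succ

/-! ### Syntactic operations and measures -/

/-- `¬ F`, by de Morgan's laws and double negation. -/
def Fml.neg : {n m : ℕ} → Fml n m → Fml n m
  | _, _, .mem a b => .nmem a b
  | _, _, .nmem a b => .mem a b
  | _, _, .rel U a => .nrel U a
  | _, _, .nrel U a => .rel U a
  | _, _, .lev α a => .nlev α a
  | _, _, .nlev α a => .lev α a
  | _, _, .or F G => .and F.neg G.neg
  | _, _, .and F G => .or F.neg G.neg
  | _, _, .bex a F => .ball a F.neg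
  | _, _, .ball a F => .bex a F.neg
  | _, _, .exL α F => .allL α F.neg
  | _, _, .allL α F => .exL α F.neg
  | _, _, .ex F => .all F.neg
  | _, _, .all F => .ex F.neg
  | _, _, .exR F => .allR F.neg
  | _, _, .allR F => .exR F.neg

/-- `F^{(a)}`: every unbounded set quantifier `Q x` becomes `(Q x ∈ a)`. -/
def Fml.restrict : {n m : ℕ} → Fml n m → Term n → Fml n m
  | _, _, .mem a b, _ => .mem a b
  | _, _, .nmem a b, _ => .nmem a b
  | _, _, .rel U a, _ => .rel U a
  | _, _, .nrel U a, _ => .nrel U a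
  | _, _, .lev α a, _ => .lev α a
  | _, _, .nlev α a, _ => .nlev α a
  | _, _, .or F G, c => .or (F.restrict c) (G.restrict c)
  | _, _, .and F G, c => .and (F.restrict c) (G.restrict c)
  | _, _, .bex a F, c => .bex a (F.restrict c.wk)
  | _, _, .ball a F, c => .ball a (F.restrict c.wk)
  | _, _, .exL α F, c => .exL α (F.restrict c.wk)
  | _, _, .allL α F, c => .allL α (F.restrict c.wk)
  | _, _, .ex F, c => .bex c (F.restrict c.wk)
  | _, _, .all F, c => .ball c (F.restrict c.wk)
  | _, _, .exR F, c => .exR (F.restrict c)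
  | _, _, .allR F, c => .allR (F.restrict c)

/-- `F^β`: every unbounded existential set quantifier `∃ x` becomes `∃ x^β`. -/
def Fml.atLevel (β : Level) : {n m : ℕ} → Fml n m → Fml n m
  | _, _, .mem a b => .mem a b
  | _, _, .nmem a b => .nmem a b
  | _, _, .rel U a => .rel U a
  | _, _, .nrel U a => .nrel U a
  | _, _, .lev α a => .lev α a
  | _, _, .nlev α a => .nlev α a
  | _, _, .or F G => .or (F.atLevel β) (G.atLevel β)
  | _, _, .and F G => .and (F.atLevel β) (G.atLevel β)
  | _, _, .bex a F => .bex a (F.atLevel β)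
  | _, _, .ball a F => .ball a (F.atLevel β)
  | _, _, .exL α F => .exL α (F.atLevel β)
  | _, _, .allL α F => .allL α (F.atLevel β)
  | _, _, .ex F => .exL β (F.atLevel β)
  | _, _, .all F => .all (F.atLevel β)
  | _, _, .exR F => .exR (F.atLevel β)
  | _, _, .allR F => .allR (F.atLevel β)

/-- `Δ₀` formulas of the language without the `M_α` and `Q x^α`: relation variables may occur as
parameters, relation quantifiers and unbounded set quantifiers may not. -/
def Fml.IsDelta0 : {n m : ℕ} → Fml n m → Prop
  | _, _, .mem _ _ => True
  | _, _, .nmem _ _ => True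
  | _, _, .rel _ _ => True
  | _, _, .nrel _ _ => True
  | _, _, .lev _ _ => False
  | _, _, .nlev _ _ => False
  | _, _, .or F G => F.IsDelta0 ∧ G.IsDelta0
  | _, _, .and F G => F.IsDelta0 ∧ G.IsDelta0
  | _, _, .bex _ F => F.IsDelta0
  | _, _, .ball _ F => F.IsDelta0
  | _, _, .exL _ _ => False
  | _, _, .allL _ _ => False
  | _, _, .ex _ => False
  | _, _, .all _ => False
  | _, _, .exR _ => False
  | _, _, .allR _ => False

/-- The class `𝓓`: no unbounded set quantifiers and no relation quantifiers. -/
def Fml.IsD : {n m : ℕ} → Fml n m → Prop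
  | _, _, .mem _ _ => True
  | _, _, .nmem _ _ => True
  | _, _, .rel _ _ => True
  | _, _, .nrel _ _ => True
  | _, _, .lev _ _ => True
  | _, _, .nlev _ _ => True
  | _, _, .or F G => F.IsD ∧ G.IsD
  | _, _, .and F G => F.IsD ∧ G.IsD
  | _, _, .bex _ F => F.IsD
  | _, _, .ball _ F => F.IsD
  | _, _, .exL _ F => F.IsD
  | _, _, .allL _ F => F.IsD
  | _, _, .ex _ => False
  | _, _, .all _ => False
  | _, _, .exR _ => False
  | _, _, .allR _ => False

/-- The class `𝓑`: no unbounded set quantifiers. -/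
def Fml.IsB : {n m : ℕ} → Fml n m → Prop
  | _, _, .mem _ _ => True
  | _, _, .nmem _ _ => True
  | _, _, .rel _ _ => True
  | _, _, .nrel _ _ => True
  | _, _, .lev _ _ => True
  | _, _, .nlev _ _ => True
  | _, _, .or F G => F.IsB ∧ G.IsB
  | _, _, .and F G => F.IsB ∧ G.IsB
  | _, _, .bex _ F => F.IsB
  | _, _, .ball _ F => F.IsB
  | _, _, .exL _ F => F.IsB
  | _, _, .allL _ F => F.IsB
  | _, _, .ex _ => False
  | _, _, .all _ => False
  | _, _, .exR F => F.IsB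
  | _, _, .allR F => F.IsB

/-- The class `𝓢`: the closure of `𝓓` under `∨`, `∧`, the quantifiers `Q x^α`, the bounded
quantifiers `(Q x ∈ a)` and the unbounded quantifier `∃ x`. -/
inductive Fml.IsS : {n m : ℕ} → Fml n m → Prop
  | ofD {n m : ℕ} {F : Fml n m} : F.IsD → IsS F
  | or {n m : ℕ} {F G : Fml n m} : IsS F → IsS G → IsS (.or F G)
  | and {n m : ℕ} {F G : Fml n m} : IsS F → IsS G → IsS (.and F G)
  | bex {n m : ℕ} {a : Term n} {F : Fml (n + 1) m} : IsS F → IsS (.bex a F)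
  | ball {n m : ℕ} {a : Term n} {F : Fml (n + 1) m} : IsS F → IsS (.ball a F)
  | exL {n m : ℕ} {α : Level} {F : Fml (n + 1) m} : IsS F → IsS (.exL α F)
  | allL {n m : ℕ} {α : Level} {F : Fml (n + 1) m} : IsS F → IsS (.allL α F)
  | ex {n m : ℕ} {F : Fml (n + 1) m} : IsS F → IsS (.ex F)

/-- `Σ` formulas: the closure of the `Δ₀` formulas under `∨`, `∧`, bounded quantifiers and the
unbounded quantifier `∃ x`. -/
inductive Fml.IsSigma : {n m : ℕ} → Fml n m → Prop
  | ofDelta0 {n m : ℕ} {F : Fml n m} : F.IsDelta0 → IsSigma F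
  | or {n m : ℕ} {F G : Fml n m} : IsSigma F → IsSigma G → IsSigma (.or F G)
  | and {n m : ℕ} {F G : Fml n m} : IsSigma F → IsSigma G → IsSigma (.and F G)
  | bex {n m : ℕ} {a : Term n} {F : Fml (n + 1) m} : IsSigma F → IsSigma (.bex a F)
  | ball {n m : ℕ} {a : Term n} {F : Fml (n + 1) m} : IsSigma F → IsSigma (.ball a F)
  | ex {n m : ℕ} {F : Fml (n + 1) m} : IsSigma F → IsSigma (.ex F)

/-- The class `𝓢₀`: the `Σ` formulas that are not `Δ₀`. -/
def Fml.IsS0 {n m : ℕ} (F : Fml n m) : Prop := F.IsSigma ∧ ¬ F.IsDelta0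

open Classical in
/-- The rank `rk(F)`. -/
def Fml.rank : {n m : ℕ} → Fml n m → Ordinal.{0}
  | _, _, .mem _ _ => 0
  | _, _, .nmem _ _ => 0
  | _, _, .rel _ _ => 0
  | _, _, .nrel _ _ => 0
  | _, _, .lev α _ => ω * α.1
  | _, _, .nlev α _ => ω * α.1
  | _, _, .or F G => max F.rank G.rank + 1
  | _, _, .and F G => max F.rank G.rank + 1
  | _, _, .bex _ F => (max 0 F.rank + 1) + 1
  | _, _, .ball _ F => (max 0 F.rank + 1) + 1
  | _, _, .exL α F => (max (ω * α.1) F.rank + 1) + 1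
  | _, _, .allL α F => (max (ω * α.1) F.rank + 1) + 1
  | _, _, .ex F => if F.IsDelta0 then Om else max (Om + 1) (F.rank + 3)
  | _, _, .all F => if F.IsDelta0 then Om else max (Om + 1) (F.rank + 3)
  | _, _, .exR F => F.rank + 1
  | _, _, .allR F => F.rank + 1

/-- The parameter set `|F|`. -/
def Fml.params : {n m : ℕ} → Fml n m → Set Ordinal.{0}
  | _, _, .mem _ _ => {0}
  | _, _, .nmem _ _ => {0}
  | _, _, .rel _ _ => {0}
  | _, _, .nrel _ _ => {0}
  | _, _, .lev α _ => {α.1}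
  | _, _, .nlev α _ => {α.1}
  | _, _, .or F G => F.params ∪ G.params
  | _, _, .and F G => F.params ∪ G.params
  | _, _, .bex _ F => {0} ∪ F.params
  | _, _, .ball _ F => {0} ∪ F.params
  | _, _, .exL α F => {α.1} ∪ F.params
  | _, _, .allL α F => {α.1} ∪ F.params
  | _, _, .ex F => F.params
  | _, _, .all F => F.params
  | _, _, .exR F => F.params
  | _, _, .allR F => F.params

/-- The length `ℓ(F)`. -/
def Fml.length : {n m : ℕ} → Fml n m → ℕ
  | _, _, .mem _ _ => 0
  | _, _, .nmem _ _ => 0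
  | _, _, .rel _ _ => 0
  | _, _, .nrel _ _ => 0
  | _, _, .lev _ _ => 0
  | _, _, .nlev _ _ => 0
  | _, _, .or F G => max F.length G.length + 1
  | _, _, .and F G => max F.length G.length + 1
  | _, _, .bex _ F => F.length + 1
  | _, _, .ball _ F => F.length + 1
  | _, _, .exL _ F => F.length + 1
  | _, _, .allL _ F => F.length + 1
  | _, _, .ex F => F.length + 1
  | _, _, .all F => F.length + 1
  | _, _, .exR F => F.length + 1
  | _, _, .allR F => F.length + 1

/-! ### Defined formulas -/

def Fml.imp {n m : ℕ} (F G : Fml n m) : Fml n m := .or F.neg G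

def Fml.iff {n m : ℕ} (F G : Fml n m) : Fml n m := .and (F.imp G) (G.imp F)

/-- `a = b` -/
def eqF {n m : ℕ} (a b : Term n) : Fml n m :=
  .and (.ball a (.mem (.bound 0) b.wk)) (.ball b (.mem (.bound 0) a.wk))

/-- `Tran[a]`: `(∀ x ∈ a)(∀ y ∈ x)(y ∈ a)` -/
def tranF {n m : ℕ} (a : Term n) : Fml n m :=
  .ball a (.ball (.bound 0) (.mem (.bound 0) a.wk.wk))

/-- `Ord[a]` -/
def ordF {n m : ℕ} (a : Term n) : Fml n m :=
  .and (tranF a) (.ball a (tranF (.bound 0)))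

/-- `a = b ∪ {b}`: `(∀ y ∈ a)(y ∈ b ∨ y = b) ∧ (∀ y ∈ b)(y ∈ a) ∧ b ∈ a` -/
def eqSuccF {n m : ℕ} (a b : Term n) : Fml n m :=
  .and (.ball a (.or (.mem (.bound 0) b.wk) (eqF (.bound 0) b.wk)))
    (.and (.ball b (.mem (.bound 0) a.wk)) (.mem b a))

/-- `Succ[a]` -/
def succF {n m : ℕ} (a : Term n) : Fml n m :=
  .and (ordF a) (.bex a (eqSuccF a.wk (.bound 0)))

/-- `FinOrd[a]` -/
def finOrdF {n m : ℕ} (a : Term n) : Fml n m :=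
  .and (ordF a) (.and (.or (eqF a .empty) (succF a))
    (.ball a (.or (eqF (.bound 0) .empty) (succF (.bound 0)))))

/-- `∃ z^β (a ∈ z ∧ b ∈ z)` -/
def pairF (β : Level) (a b : Term 0) : Fml 0 0 :=
  .exL β (.and (.mem a.wk (.bound 0)) (.mem b.wk (.bound 0)))

/-- `∃ z^β (∀ y ∈ a)(∀ x ∈ y)(x ∈ z)` -/
def unionF (β : Level) (a : Term 0) : Fml 0 0 :=
  .exL β (.ball a.wk (.ball (.bound 0) (.mem (.bound 0) (.bound 2))))

/-- `∃ z^β (z = {x ∈ a : A[x]})`, that is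
`∃ z^β ((∀ x ∈ z)(x ∈ a ∧ A[x]) ∧ (∀ x ∈ a)(A[x] → x ∈ z))`. -/
def sepF (β : Level) (a : Term 0) (A : Fml 1 0) : Fml 0 0 :=
  .exL β (.and
    (.ball (.bound 0) (.and (.mem (.bound 0) a.wk.wk) (A.subst fun _ => .bound 0)))
    (.ball a.wk (.imp (A.subst fun _ => .bound 0) (.mem (.bound 0) (.bound 1)))))

/-- `∃ Z (∀ x ∈ ω)(Z(x) ↔ ∀ Y A[x, Y])` -/
def compF (A : Fml 1 1) : Fml 0 0 :=
  .exR (.ball .omega (.iff (.rel (.bound 0) (.bound 0)) (.wkR (.allR A))))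

/-! ## Axioms and operator controlled derivations -/

/-- The axioms of the system. -/
inductive IsAxiom : Finset (Fml 0 0) → Prop
  | tnd (Γ : Finset (Fml 0 0)) (F : Fml 0 0) : F.IsB → IsAxiom (Γ ∪ {F.neg, F})
  | equality (Γ : Finset (Fml 0 0)) (a b : Term 0) (F : Fml 1 0) : F.IsB →
      IsAxiom (Γ ∪ {(eqF a b).neg, (F.inst a).neg, F.inst b})
  | subOmega (Γ : Finset (Fml 0 0)) (U : RVar 0) (a : Term 0) :
      IsAxiom (Γ ∪ {.nrel U a, .mem a .omega})
  | levZero (Γ : Finset (Fml 0 0)) (a : Term 0) : IsAxiom (Γ ∪ {.nlev Level.zero a})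
  | levEmpty (Γ : Finset (Fml 0 0)) : IsAxiom (Γ ∪ {.lev Level.one .empty})
  | emptySet (Γ : Finset (Fml 0 0)) (a : Term 0) : IsAxiom (Γ ∪ {.nmem a .empty})
  | levOmega (Γ : Finset (Fml 0 0)) :
      IsAxiom (Γ ∪ {.lev (Level.omega.add Level.one) .omega})
  | infinity (Γ : Finset (Fml 0 0)) (a : Term 0) :
      IsAxiom (Γ ∪ {.iff (.mem a .omega) (finOrdF a)})
  | levMono (Γ : Finset (Fml 0 0)) (α β : Level) (a : Term 0) : α ≤ β →
      IsAxiom (Γ ∪ {.nlev α a, .lev β a})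
  | levMem (Γ : Finset (Fml 0 0)) (α : Level) (a b : Term 0) :
      IsAxiom (Γ ∪ {.nlev (α.add Level.one) a, .nmem b a, .lev α b})
  | pair (Γ : Finset (Fml 0 0)) (α β : Level) (a b : Term 0) : α ≤ β →
      IsAxiom (Γ ∪ {.nlev α a, .nlev β b, pairF (β.add Level.one) a b})
  | union (Γ : Finset (Fml 0 0)) (α : Level) (a : Term 0) :
      IsAxiom (Γ ∪ {.nlev α a, unionF α a})
  | sep (Γ : Finset (Fml 0 0)) (α : Level) (a : Term 0) (A : Fml 1 0) : A.IsDelta0 →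
      IsAxiom (Γ ∪ {.nlev α a, sepF (α.add Level.one) a A})
  | comp (Γ : Finset (Fml 0 0)) (A : Fml 1 1) : A.IsDelta0 → IsAxiom (Γ ∪ {compF A})

/-- `|Γ|` -/
def params (Γ : Finset (Fml 0 0)) : Set Ordinal.{0} := ⋃ F ∈ Γ, F.params

/-- Operators on sets of ordinals. -/
abbrev Operator : Type 1 := Set Ordinal.{0} → Set Ordinal.{0}

/-- `𝓗[𝔪]` -/
def Operator.relativize (H : Operator) (s : Set Ordinal.{0}) : Operator := fun X => H (s ∪ X)

/-- The operator `𝓗_σ`. -/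
def Hop (σ : Ordinal.{0}) : Operator := fun X =>
  ⋂₀ {Y | ∃ α β : Ordinal.{0}, Y = C α β ∧ X ⊆ C α β ∧ σ < α}

/-- The requirements on every sequent `Θ` of a derivation, where it is derived with depth `α`:
`{α} ∪ |Θ| ⊆ 𝓗(∅)`, and all elements of `Θ` have length `< p`. -/
def Controlled (p : ℕ∞) (H : Operator) (α : Ordinal.{0}) (Θ : Finset (Fml 0 0)) : Prop :=
  {α} ∪ params Θ ⊆ H ∅ ∧ ∀ F ∈ Θ, (F.length : ℕ∞) < p

/-- `DerivesLt p ρ H α Θ`: the operator controlled derivability relation `𝓗 ⊢^α_{ρ,p} Θ`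
(depth `α`, cut rank `ρ`, all formulas of length `< p`); `p = ⊤` imposes no bound on lengths.
The bound `β` on the premises of the rules for `∃ x^τ` and `∀ x^τ` refers to the superscript `τ` of
the quantifier. -/
inductive DerivesLt (p : ℕ∞) (ρ : Ordinal.{0}) :
    Operator → Ordinal.{0} → Finset (Fml 0 0) → Prop
  | ax {H : Operator} {α : Ordinal.{0}} {Θ : Finset (Fml 0 0)} :
      IsAxiom Θ → Controlled p H α Θ → DerivesLt p ρ H α Θ
  | or {H : Operator} {α α₀ : Ordinal.{0}} {Γ : Finset (Fml 0 0)} {F G : Fml 0 0} :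
      α₀ < α →
      DerivesLt p ρ H α₀ (Γ ∪ {F, G}) →
      Controlled p H α (Γ ∪ {.or F G}) → DerivesLt p ρ H α (Γ ∪ {.or F G})
  | and {H : Operator} {α α₀ α₁ : Ordinal.{0}} {Γ : Finset (Fml 0 0)} {F G : Fml 0 0} :
      α₀ < α → α₁ < α →
      DerivesLt p ρ H α₀ (Γ ∪ {F}) → DerivesLt p ρ H α₁ (Γ ∪ {G}) →
      Controlled p H α (Γ ∪ {.and F G}) → DerivesLt p ρ H α (Γ ∪ {.and F G})
  | nlev {H : Operator} {α : Ordinal.{0}} {Γ : Finset (Fml 0 0)} {l : Level} {a : Term 0}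
      (d : Level → Ordinal.{0}) :
      Order.IsSuccLimit l.1 → (∀ β : Level, β < l → d β < α) →
      (∀ β : Level, β < l → DerivesLt p ρ (H.relativize {β.1}) (d β) (Γ ∪ {.nlev β a})) →
      Controlled p H α (Γ ∪ {.nlev l a}) → DerivesLt p ρ H α (Γ ∪ {.nlev l a})
  | ex {H : Operator} {α α₀ : Ordinal.{0}} {Γ : Finset (Fml 0 0)} {F : Fml 1 0}
      {β : Level} {a : Term 0} :
      α₀ < α → β.1 < α →
      DerivesLt p ρ H α₀ (Γ ∪ {.and (.lev β a) (F.inst a)}) →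
      Controlled p H α (Γ ∪ {.ex F}) → DerivesLt p ρ H α (Γ ∪ {.ex F})
  | all {H : Operator} {α : Ordinal.{0}} {Γ : Finset (Fml 0 0)} {F : Fml 1 0}
      (d : Level → Ordinal.{0}) :
      (∀ β : Level, β.1 < d β ∧ d β < α) →
      (∀ (β : Level) (a : Term 0),
        DerivesLt p ρ (H.relativize {β.1}) (d β) (Γ ∪ {.or (.nlev β a) (F.inst a)})) →
      Controlled p H α (Γ ∪ {.all F}) → DerivesLt p ρ H α (Γ ∪ {.all F})
  | exL {H : Operator} {α α₀ : Ordinal.{0}} {Γ : Finset (Fml 0 0)} {τ : Level} {F : Fml 1 0}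
      {β : Level} {a : Term 0} :
      α₀ < α → β ≤ τ →
      DerivesLt p ρ H α₀ (Γ ∪ {.and (.lev β a) (F.inst a)}) →
      Controlled p H α (Γ ∪ {.exL τ F}) → DerivesLt p ρ H α (Γ ∪ {.exL τ F})
  | allL {H : Operator} {α : Ordinal.{0}} {Γ : Finset (Fml 0 0)} {τ : Level} {F : Fml 1 0}
      (d : Level → Ordinal.{0}) :
      (∀ β : Level, β ≤ τ → d β < α) →
      (∀ (β : Level) (a : Term 0), β ≤ τ →
        DerivesLt p ρ (H.relativize {β.1}) (d β) (Γ ∪ {.or (.nlev β a) (F.inst a)})) →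
      Controlled p H α (Γ ∪ {.allL τ F}) → DerivesLt p ρ H α (Γ ∪ {.allL τ F})
  | bex {H : Operator} {α α₀ : Ordinal.{0}} {Γ : Finset (Fml 0 0)} {a : Term 0} {F : Fml 1 0}
      {b : Term 0} :
      α₀ < α →
      DerivesLt p ρ H α₀ (Γ ∪ {.and (.mem b a) (F.inst b)}) →
      Controlled p H α (Γ ∪ {.bex a F}) → DerivesLt p ρ H α (Γ ∪ {.bex a F})
  | ball {H : Operator} {α α₀ : Ordinal.{0}} {Γ : Finset (Fml 0 0)} {a : Term 0} {F : Fml 1 0} :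
      α₀ < α →
      (∀ b : Term 0, DerivesLt p ρ H α₀ (Γ ∪ {.or (.nmem b a) (F.inst b)})) →
      Controlled p H α (Γ ∪ {.ball a F}) → DerivesLt p ρ H α (Γ ∪ {.ball a F})
  | exR {H : Operator} {α α₀ : Ordinal.{0}} {Γ : Finset (Fml 0 0)} {F : Fml 0 1} {U : RVar 0} :
      α₀ < α →
      DerivesLt p ρ H α₀ (Γ ∪ {F.instR U}) →
      Controlled p H α (Γ ∪ {.exR F}) → DerivesLt p ρ H α (Γ ∪ {.exR F})
  | allR {H : Operator} {α α₀ : Ordinal.{0}} {Γ : Finset (Fml 0 0)} {F : Fml 0 1} :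
      α₀ < α →
      (∀ U : RVar 0, DerivesLt p ρ H α₀ (Γ ∪ {F.instR U})) →
      Controlled p H α (Γ ∪ {.allR F}) → DerivesLt p ρ H α (Γ ∪ {.allR F})
  | cut {H : Operator} {α α₀ : Ordinal.{0}} {Γ : Finset (Fml 0 0)} {F : Fml 0 0} :
      α₀ < α → F.rank < ρ → (F.length : ℕ∞) < p →
      DerivesLt p ρ H α₀ (Γ ∪ {F}) → DerivesLt p ρ H α₀ (Γ ∪ {F.neg}) →
      Controlled p H α Γ → DerivesLt p ρ H α Γ
  | ref {H : Operator} {α α₀ : Ordinal.{0}} {Γ : Finset (Fml 0 0)} {F : Fml 0 0} :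
      α₀ < α → Om < α → F.IsS0 →
      DerivesLt p ρ H α₀ (Γ ∪ {F}) →
      Controlled p H α (Γ ∪ {.ex (F.wk.restrict (.bound 0))}) →
      DerivesLt p ρ H α (Γ ∪ {.ex (F.wk.restrict (.bound 0))})
  | bc {H : Operator} {α α₀ : Ordinal.{0}} {Γ : Finset (Fml 0 0)} {F : Fml 0 0} {β : Level} :
      α₀ < α → F.IsS0 →
      DerivesLt p ρ H α₀ (Γ ∪ {F.atLevel β}) →
      Controlled p H α (Γ ∪ {.exL (β.add Level.omega) (F.wk.restrict (.bound 0))}) →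
      DerivesLt p ρ H α (Γ ∪ {.exL (β.add Level.omega) (F.wk.restrict (.bound 0))})

/-- `𝓗 ⊢^α_ρ Θ`, without a bound on the lengths of formulas. -/
def Derives (ρ : Ordinal.{0}) (H : Operator) (α : Ordinal.{0}) (Θ : Finset (Fml 0 0)) : Prop :=
  DerivesLt ⊤ ρ H α Θ

/-- `α̂ = σ + ω ^ (Ω + α)` -/
def hat (σ α : Ordinal.{0}) : Ordinal.{0} := σ + ω ^ (Om + α)

end RSStar

end

open RSStar

/-!
The theorem is Buchholz-style impredicative collapsing for operator controlled derivations. Both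
parts are the instances `p = ⊤` and `p < ω` of one statement (`RSStar.CollapsesAt`), proved by
induction on the depth `α`, simultaneously for all `σ` and `Γ` (`RSStar.collapsesAt`).

Write `α̂` for `hat σ α`. If a premise has depth `α₀ < α`, then `α₀` is controlled by `H_σ[Γ]`,
hence lies in `C(σ + 1, ψ(σ + 1)) ⊆ C(α̂, ψ(α̂))`, and therefore `ψ(α̂₀) < ψ(α̂)`: collapsing respects depths
(`RSStar.Collapsible.psi_hat_lt`). Most rules then commute with collapsing. The rules with a premise
for every level below a parameter of `Γ` do so because all these levels are below `ψ(σ + 1)`; the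
rule for `∀ x`, which has premises for all levels, cannot end a derivation of a sequent from
`𝓢 ∪ 𝓑`. A cut formula of rank less than `Ω` belongs to `𝓑`, and as its parameters are controlled,
its rank is less than `ψ(α̂)` (`RSStar.Fml.IsB.rank_lt_psi`).

Two cases need more. For a cut with `∃ x A` of rank `Ω`, the collapsed first premise has depth
`β = ψ(α̂₀)`, and a derivation of depth `β` uses only witnesses of level below `β`
(`RSStar.DerivesLt.boundedness`), so it proves `∃ x^β A`. The second premise is inverted to
`∀ x^β ¬A` (`RSStar.DerivesLt.weaken_all`), a formula of `𝓑`, and the induction hypothesis applies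
to it with `α̂₀` in place of `σ`; the new depth is below `ψ(α̂)` since
`α̂₀ + ω^(Ω + α₀) < α̂`. For reflection, boundedness turns `F` into `F^β`, the rule `BC` gives
`∃ z^(β+ω) F^(z)`, and `RSStar.DerivesLt.ex_of_exL` gives `∃ z F^(z)`.

That `β` is a level uses that `σ` and all depths are below `ε_{Ω+1}`: the parameters of `Γ` are
levels, so `H_σ[Γ](∅)` is contained in `C(a, 0)` for `a > σ`, `a ≥ ε_{Ω+1}`, and no `C(a, 0)` reaches
`ε_{Ω+1}`.
-/

namespace RSStar

/-! ### The sets `C(α, β)` and the collapsing function -/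

theorem isPrincipal_add_Om : IsPrincipal (· + ·) Om := isPrincipal_add_omega 1

theorem omega0_lt_Om : ω < Om := omega0_lt_omega_one

theorem opow_lt_Om {ξ : Ordinal.{0}} (h : ξ < Om) : ω ^ ξ < Om :=
  isPrincipal_opow_omega 1 omega0_lt_Om h

theorem C_mono {α α' β β' : Ordinal.{0}} (hα : α ≤ α') (hβ : β ≤ β') : C α β ⊆ C α' β' := by
  intro ξ h
  induction h with
  | zero => exact Closure.zero
  | omega => exact Closure.omega
  | base h => exact Closure.base (h.trans_le hβ)
  | add _ _ h₁ h₂ => exact Closure.add h₁ h₂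
  | opow _ h => exact Closure.opow h
  | collapse h _ ih => exact Closure.collapse (f := fun ζ _ => psi ζ) (h.trans_le hα) ih

theorem psi_mem_C {α β ξ : Ordinal.{0}} (h : ξ < α) (hξ : ξ ∈ C α β) : psi ξ ∈ C α β :=
  Closure.collapse (f := fun ζ _ => psi ζ) h hξ

theorem one_mem_C (α β : Ordinal.{0}) : 1 ∈ C α β := by
  simpa using! (Closure.opow Closure.zero : Closure α (fun ζ _ => psi ζ) β (ω ^ (0 : Ordinal.{0})))

theorem omega0_mem_C (α β : Ordinal.{0}) : ω ∈ C α β := by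
  simpa using!
    (Closure.opow (one_mem_C α β) : Closure α (fun ζ _ => psi ζ) β (ω ^ (1 : Ordinal.{0})))

theorem countable_Iio {η : Ordinal.{0}} (h : η < Om) : (Iio η).Countable := by
  have h1 : η.card < Cardinal.aleph 1 := Cardinal.lt_omega_iff_card_lt.1 h
  rw [← Cardinal.succ_aleph0, Order.lt_succ_iff] at h1
  rw [← Cardinal.le_aleph0_iff_set_countable, Cardinal.mk_Iio_ordinal, Cardinal.lift_le_aleph0]
  exact h1

/-- For countable `η` the set `C(α, η)` is the union of countably many countable stages. -/
theorem countable_C (α : Ordinal.{0}) {η : Ordinal.{0}} (h : η < Om) : (C α η).Countable := by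
  let step : Set Ordinal.{0} → Set Ordinal.{0} := fun S =>
    S ∪ (image2 (· + ·) S S ∪ ((fun ξ => ω ^ ξ) '' S ∪ psi '' S))
  let T : ℕ → Set Ordinal.{0} := fun n => step^[n] ({0, Om} ∪ Iio η)
  have hsucc : ∀ n, T (n + 1) = step (T n) := fun n => Function.iterate_succ_apply' step n _
  have hc : ∀ n, (T n).Countable := by
    intro n
    induction n with
    | zero => exact (Set.toFinite {0, Om}).countable.union (countable_Iio h)
    | succ n ih =>
      rw [hsucc]
      exact ih.union ((ih.image2 ih _).union ((ih.image _).union (ih.image _)))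
  have hm : Monotone T := monotone_nat_of_le_succ fun n => by
    rw [hsucc]; exact subset_union_left
  refine (countable_iUnion hc).mono fun ξ hξ => ?_
  rw [mem_iUnion]
  induction hξ with
  | zero => exact ⟨0, by simp [T]⟩
  | omega => exact ⟨0, by simp [T]⟩
  | base h => exact ⟨0, Or.inr h⟩
  | @add ξ ζ _ _ h₁ h₂ =>
    obtain ⟨n, hn⟩ := h₁
    obtain ⟨k, hk⟩ := h₂
    refine ⟨max n k + 1, ?_⟩
    rw [hsucc]
    exact Or.inr (Or.inl (mem_image2_of_mem (hm (le_max_left _ _) hn) (hm (le_max_right _ _) hk)))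
  | opow _ h =>
    obtain ⟨n, hn⟩ := h
    exact ⟨n + 1, by rw [hsucc]; exact Or.inr (Or.inr (Or.inl (mem_image_of_mem _ hn)))⟩
  | collapse _ _ h =>
    obtain ⟨n, hn⟩ := h
    exact ⟨n + 1, by rw [hsucc]; exact Or.inr (Or.inr (Or.inr (mem_image_of_mem _ hn)))⟩

theorem exists_C_of_iSup {α : Ordinal.{0}} {e : ℕ → Ordinal.{0}} (he : Monotone e)
    {ξ : Ordinal.{0}} (h : ξ ∈ C α (⨆ n, e n)) : ∃ n, ξ ∈ C α (e n) := by
  induction h with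
  | zero => exact ⟨0, Closure.zero⟩
  | omega => exact ⟨0, Closure.omega⟩
  | base h =>
    obtain ⟨n, hn⟩ := Ordinal.lt_iSup_iff.1 h
    exact ⟨n, Closure.base hn⟩
  | add _ _ h₁ h₂ =>
    obtain ⟨n, hn⟩ := h₁
    obtain ⟨k, hk⟩ := h₂
    exact ⟨max n k, Closure.add (C_mono le_rfl (he (le_max_left _ _)) hn)
      (C_mono le_rfl (he (le_max_right _ _)) hk)⟩
  | opow _ h =>
    obtain ⟨n, hn⟩ := h
    exact ⟨n, Closure.opow hn⟩
  | collapse h _ ih =>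
    obtain ⟨n, hn⟩ := ih
    exact ⟨n, psi_mem_C h hn⟩

/-- Some countable `η` satisfies `C(α, η) ∩ Ω = η`: the supremum of a sequence in which `η_{n+1}`
exceeds all countable elements of `C(α, η_n)`. -/
theorem exists_C_inter_eq (α : Ordinal.{0}) : ∃ η < Om, C α η ∩ Iio Om = Iio η := by
  let s : Ordinal.{0} → Ordinal.{0} := fun η =>
    max η (⨆ ξ : (C α η ∩ Iio Om : Set Ordinal.{0}), (ξ.1 + 1))
  let e : ℕ → Ordinal.{0} := fun n => s^[n] 0
  have hsucc : ∀ n, e (n + 1) = s (e n) := fun n => Function.iterate_succ_apply' s n _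
  have hm : Monotone e := monotone_nat_of_le_succ fun n => by
    rw [hsucc]; exact le_max_left _ _
  have hlt : ∀ {η : Ordinal.{0}}, ∀ ξ : (C α η ∩ Iio Om : Set Ordinal.{0}), ξ.1 + 1 < Om :=
    fun ξ => isPrincipal_add_Om ξ.2.2 (one_lt_omega0.trans omega0_lt_Om)
  have hOm : ∀ n, e n < Om := by
    intro n
    induction n with
    | zero => exact omega_pos 1
    | succ n ih =>
      rw [hsucc]
      have : Countable (C α (e n) ∩ Iio Om : Set Ordinal.{0}) :=
        ((countable_C α ih).mono inter_subset_left).to_subtype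
      exact max_lt ih (iSup_lt_omega_one hlt)
  refine ⟨⨆ n, e n, iSup_lt_omega_one hOm, ?_⟩
  ext ξ
  constructor
  · rintro ⟨h, hξ⟩
    obtain ⟨n, hn⟩ := exists_C_of_iSup hm h
    refine Ordinal.lt_iSup_iff.2 ⟨n + 1, ?_⟩
    rw [hsucc]
    refine lt_max_of_lt_right ((lt_add_one ξ).trans_le ?_)
    exact le_ciSup (f := fun ξ : (C α (e n) ∩ Iio Om : Set Ordinal.{0}) => ξ.1 + 1)
      ⟨Om, by rintro _ ⟨ζ, rfl⟩; exact (hlt ζ).le⟩ ⟨ξ, hn, hξ⟩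
  · intro h
    exact ⟨Closure.base h, lt_trans h (iSup_lt_omega_one hOm)⟩

theorem psi_lt_Om (α : Ordinal.{0}) : psi α < Om := by
  obtain ⟨η, hη, h⟩ := exists_C_inter_eq α
  rw [psi_eq]
  exact lt_of_le_of_lt (csInf_le' (a := η) h) hη

theorem C_psi_inter (α : Ordinal.{0}) : C α (psi α) ∩ Iio Om = Iio (psi α) := by
  obtain ⟨η, -, h⟩ := exists_C_inter_eq α
  have := csInf_mem (s := {η | C α η ∩ Iio Om = Iio η}) ⟨η, h⟩
  rwa [← psi_eq] at this

theorem lt_psi_of_mem {α ξ : Ordinal.{0}} (h : ξ ∈ C α (psi α)) (hξ : ξ < Om) : ξ < psi α := by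
  have : ξ ∈ C α (psi α) ∩ Iio Om := ⟨h, hξ⟩
  rwa [C_psi_inter] at this

theorem psi_mono {α α' : Ordinal.{0}} (h : α ≤ α') : psi α ≤ psi α' := by
  rw [psi_eq α]
  refine csInf_le' (a := psi α') (Subset.antisymm ?_ fun ξ hξ =>
    ⟨Closure.base hξ, lt_trans hξ (psi_lt_Om _)⟩)
  rw [← C_psi_inter α']
  exact inter_subset_inter_left _ (C_mono h le_rfl)

theorem psi_lt_psi {α α' : Ordinal.{0}} (h : α < α') (hα : α ∈ C α' (psi α')) :
    psi α < psi α' :=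
  lt_psi_of_mem (psi_mem_C h hα) (psi_lt_Om _)

theorem zero_lt_psi (α : Ordinal.{0}) : 0 < psi α := lt_psi_of_mem Closure.zero (omega_pos 1)

theorem omega0_lt_psi (α : Ordinal.{0}) : ω < psi α :=
  lt_psi_of_mem (omega0_mem_C _ _) omega0_lt_Om

theorem add_lt_psi {α ξ ζ : Ordinal.{0}} (h : ξ < psi α) (h' : ζ < psi α) : ξ + ζ < psi α :=
  lt_psi_of_mem (Closure.add (Closure.base h) (Closure.base h'))
    (isPrincipal_add_Om (h.trans (psi_lt_Om _)) (h'.trans (psi_lt_Om _)))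

theorem add_one_lt_psi {α ξ : Ordinal.{0}} (h : ξ < psi α) : ξ + 1 < psi α :=
  add_lt_psi h (one_lt_omega0.trans (omega0_lt_psi α))

theorem opow_lt_psi {α ξ : Ordinal.{0}} (h : ξ < psi α) : ω ^ ξ < psi α :=
  lt_psi_of_mem (Closure.opow (Closure.base h)) (opow_lt_Om (h.trans (psi_lt_Om _)))

theorem omega0_mul_le_opow (ξ : Ordinal.{0}) : ω * ξ ≤ ω ^ (1 + ξ) := by
  rw [opow_add, opow_one]
  gcongr
  exact right_le_opow ξ one_lt_omega0

theorem omega0_mul_lt_psi {α ξ : Ordinal.{0}} (h : ξ < psi α) : ω * ξ < psi α :=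
  (omega0_mul_le_opow ξ).trans_lt
    (opow_lt_psi (add_lt_psi (one_lt_omega0.trans (omega0_lt_psi α)) h))

theorem omega0_mul_lt_Om {ξ : Ordinal.{0}} (h : ξ < Om) : ω * ξ < Om :=
  (omega0_mul_le_opow ξ).trans_lt
    (opow_lt_Om (isPrincipal_add_Om (one_lt_omega0.trans omega0_lt_Om) h))

theorem epsOm_spec : Om < epsOm ∧ ω ^ epsOm = epsOm := by
  refine csInf_mem (s := {α : Ordinal.{0} | Om < α ∧ ω ^ α = α})
    ⟨nfp (fun ξ => ω ^ ξ) (Om + 1), ?_, ?_⟩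
  · exact (lt_add_one Om).trans_le (le_nfp _ _)
  · exact nfp_fp (isNormal_opow one_lt_omega0) _

theorem C_zero_lt_epsOm {α ξ : Ordinal.{0}} (h : ξ ∈ C α 0) : ξ < epsOm := by
  obtain ⟨h₁, h₂⟩ := epsOm_spec
  induction h with
  | zero => exact (omega_pos 1).trans h₁
  | omega => exact h₁
  | base h => exact absurd h not_lt_zero
  | add _ _ ih ih' =>
    rw [← h₂] at ih ih' ⊢
    exact isPrincipal_add_omega0_opow _ ih ih'
  | opow _ ih =>
    rw [← h₂]
    exact (opow_lt_opow_iff_right one_lt_omega0).2 ih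
  | collapse _ _ _ => exact (psi_lt_Om _).trans h₁

theorem lt_hat (σ α : Ordinal.{0}) : σ < hat σ α :=
  lt_add_of_pos_right σ (opow_pos _ omega0_pos)

theorem opow_Om_add_lt {α α' : Ordinal.{0}} (h : α < α') : ω ^ (Om + α) < ω ^ (Om + α') :=
  (opow_lt_opow_iff_right one_lt_omega0).2 ((add_lt_add_iff_left Om).2 h)

theorem hat_lt_hat (σ : Ordinal.{0}) {α α' : Ordinal.{0}} (h : α < α') : hat σ α < hat σ α' :=
  (add_lt_add_iff_left σ).2 (opow_Om_add_lt h)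

theorem hat_hat_lt_hat (σ : Ordinal.{0}) {α α' : Ordinal.{0}} (h : α < α') :
    hat (hat σ α) α < hat σ α' := by
  unfold hat
  rw [add_assoc]
  exact (add_lt_add_iff_left σ).2
    (isPrincipal_add_omega0_opow _ (opow_Om_add_lt h) (opow_Om_add_lt h))

theorem hat_mem_C {a b σ α : Ordinal.{0}} (hσ : σ ∈ C a b) (hα : α ∈ C a b) :
    hat σ α ∈ C a b :=
  Closure.add hσ (Closure.opow (Closure.add Closure.omega hα))

/-! ### The operators `H_σ` -/

theorem mem_Hop {σ ξ : Ordinal.{0}} {X : Set Ordinal.{0}} :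
    ξ ∈ Hop σ X ↔ ∀ a b : Ordinal.{0}, X ⊆ C a b → σ < a → ξ ∈ C a b := by
  constructor
  · intro h a b hX ha
    exact h _ ⟨a, b, rfl, hX, ha⟩
  · rintro h _ ⟨a, b, rfl, hX, ha⟩
    exact h a b hX ha

theorem subset_Hop (σ : Ordinal.{0}) (X : Set Ordinal.{0}) : X ⊆ Hop σ X :=
  fun _ h => mem_Hop.2 fun _ _ hX _ => hX h

/-- `H_σ(X) ⊆ H_τ(Y)` for `σ ≤ τ` and `X ⊆ H_τ(Y)`. -/
theorem Hop_subset_Hop {σ τ : Ordinal.{0}} {X Y : Set Ordinal.{0}} (h : σ ≤ τ)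
    (hX : X ⊆ Hop τ Y) : Hop σ X ⊆ Hop τ Y := fun _ hξ =>
  mem_Hop.2 fun a b hY ha =>
    mem_Hop.1 hξ a b (fun _ hζ => mem_Hop.1 (hX hζ) a b hY ha) (h.trans_lt ha)

theorem Hop_mono (σ : Ordinal.{0}) : Monotone (Hop σ) := fun _ _ h =>
  Hop_subset_Hop le_rfl (h.trans (subset_Hop σ _))

theorem _root_.Monotone.relativize {H : Operator} (h : Monotone H) (s : Set Ordinal.{0}) :
    Monotone (H.relativize s) := fun _ _ hX => h (union_subset_union_right s hX)

theorem zero_mem_Hop (σ : Ordinal.{0}) (X : Set Ordinal.{0}) : 0 ∈ Hop σ X :=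
  mem_Hop.2 fun _ _ _ _ => Closure.zero

theorem one_mem_Hop (σ : Ordinal.{0}) (X : Set Ordinal.{0}) : 1 ∈ Hop σ X :=
  mem_Hop.2 fun _ _ _ _ => one_mem_C _ _

theorem omega0_mem_Hop (σ : Ordinal.{0}) (X : Set Ordinal.{0}) : ω ∈ Hop σ X :=
  mem_Hop.2 fun _ _ _ _ => omega0_mem_C _ _

theorem add_mem_Hop {σ ξ ζ : Ordinal.{0}} {X : Set Ordinal.{0}} (h : ξ ∈ Hop σ X)
    (h' : ζ ∈ Hop σ X) : ξ + ζ ∈ Hop σ X :=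
  mem_Hop.2 fun a b hX ha => Closure.add (mem_Hop.1 h a b hX ha) (mem_Hop.1 h' a b hX ha)

theorem hat_mem_Hop {τ σ α : Ordinal.{0}} {X : Set Ordinal.{0}} (hσ : σ ∈ Hop τ X)
    (hα : α ∈ Hop τ X) : hat σ α ∈ Hop τ X :=
  mem_Hop.2 fun a b hX ha => hat_mem_C (mem_Hop.1 hσ a b hX ha) (mem_Hop.1 hα a b hX ha)

theorem psi_mem_Hop {σ τ : Ordinal.{0}} {X : Set Ordinal.{0}} (h : τ ≤ σ) (hτ : τ ∈ Hop σ X) :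
    psi τ ∈ Hop σ X :=
  mem_Hop.2 fun a b hX ha => psi_mem_C (h.trans_lt ha) (mem_Hop.1 hτ a b hX ha)

/-! ### Syntactic classes and measures under substitution, negation and relativization -/

namespace Fml

variable {n m k : ℕ}

@[simp] theorem neg_neg (F : Fml n m) : F.neg.neg = F := by
  induction F <;> simp_all [Fml.neg]

@[simp] theorem length_neg (F : Fml n m) : F.neg.length = F.length := by
  induction F <;> simp_all [Fml.neg, Fml.length]

@[simp] theorem length_subst (F : Fml n m) (s : Fin n → Term k) :
    (F.subst s).length = F.length := by
  induction F generalizing k <;> simp_all [Fml.subst, Fml.length]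

@[simp] theorem length_atLevel (β : Level) (F : Fml n m) : (F.atLevel β).length = F.length := by
  induction F <;> simp_all [Fml.atLevel, Fml.length]

@[simp] theorem params_neg (F : Fml n m) : F.neg.params = F.params := by
  induction F <;> simp_all [Fml.neg, Fml.params]

@[simp] theorem params_subst (F : Fml n m) (s : Fin n → Term k) :
    (F.subst s).params = F.params := by
  induction F generalizing k <;> simp_all [Fml.subst, Fml.params]

theorem params_atLevel (β : Level) (F : Fml n m) : (F.atLevel β).params ⊆ {β.1} ∪ F.params := by
  induction F <;> simp_all only [Fml.atLevel, Fml.params] <;> grind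

/-- Parameters are ordinals of levels. -/
theorem params_subset_level (F : Fml n m) : F.params ⊆ Iio Om ∩ C epsOm 0 := by
  have h0 : (0 : Ordinal.{0}) ∈ Iio Om ∩ C epsOm 0 := Level.zero.2
  have hl (l : Level) : l.1 ∈ Iio Om ∩ C epsOm 0 := l.2
  induction F <;>
    simp only [Fml.params, union_subset_iff, singleton_subset_iff] <;>
    grind

theorem IsB.neg {F : Fml n m} (h : F.IsB) : F.neg.IsB := by
  induction F <;> simp_all [Fml.neg, Fml.IsB]

theorem IsB.subst {F : Fml n m} (h : F.IsB) (s : Fin n → Term k) : (F.subst s).IsB := by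
  induction F generalizing k <;> simp_all [Fml.subst, Fml.IsB]

theorem IsB.substR {F : Fml n m} (h : F.IsB) (s : Fin m → RVar k) : (F.substR s).IsB := by
  induction F generalizing k <;> simp_all [Fml.substR, Fml.IsB]

theorem isB_restrict (F : Fml n m) (c : Term n) : (F.restrict c).IsB := by
  induction F <;> simp_all [Fml.restrict, Fml.IsB]

theorem IsB.atLevel_eq {F : Fml n m} (h : F.IsB) (β : Level) : F.atLevel β = F := by
  induction F <;> simp_all [Fml.atLevel, Fml.IsB]

theorem IsDelta0.isD {F : Fml n m} (h : F.IsDelta0) : F.IsD := by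
  induction F <;> simp_all [Fml.IsDelta0, Fml.IsD]

theorem IsDelta0.neg {F : Fml n m} (h : F.IsDelta0) : F.neg.IsDelta0 := by
  induction F <;> simp_all [Fml.IsDelta0, Fml.neg]

theorem IsD.isB {F : Fml n m} (h : F.IsD) : F.IsB := by
  induction F <;> simp_all [Fml.IsD, Fml.IsB]

theorem IsD.subst {F : Fml n m} (h : F.IsD) (s : Fin n → Term k) : (F.subst s).IsD := by
  induction F generalizing k <;> simp_all [Fml.subst, Fml.IsD]

theorem IsS.subst {F : Fml n m} (h : F.IsS) (s : Fin n → Term k) : (F.subst s).IsS := by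
  induction h generalizing k with
  | ofD h => exact .ofD (h.subst s)
  | or _ _ h₁ h₂ => exact .or (h₁ s) (h₂ s)
  | and _ _ h₁ h₂ => exact .and (h₁ s) (h₂ s)
  | bex _ h => exact .bex (h _)
  | ball _ h => exact .ball (h _)
  | exL _ h => exact .exL (h _)
  | allL _ h => exact .allL (h _)
  | ex _ h => exact .ex (h _)

theorem IsS.of_or {F G : Fml n m} (h : (Fml.or F G).IsS) : F.IsS ∧ G.IsS := by
  cases h with
  | ofD h => exact ⟨.ofD h.1, .ofD h.2⟩
  | or h₁ h₂ => exact ⟨h₁, h₂⟩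

theorem IsS.of_and {F G : Fml n m} (h : (Fml.and F G).IsS) : F.IsS ∧ G.IsS := by
  cases h with
  | ofD h => exact ⟨.ofD h.1, .ofD h.2⟩
  | and h₁ h₂ => exact ⟨h₁, h₂⟩

theorem IsS.of_bex {a : Term n} {F : Fml (n + 1) m} (h : (Fml.bex a F).IsS) : F.IsS := by
  cases h with
  | ofD h => exact .ofD h
  | bex h => exact h

theorem IsS.of_ball {a : Term n} {F : Fml (n + 1) m} (h : (Fml.ball a F).IsS) : F.IsS := by
  cases h with
  | ofD h => exact .ofD h
  | ball h => exact h

theorem IsS.of_exL {τ : Level} {F : Fml (n + 1) m} (h : (Fml.exL τ F).IsS) : F.IsS := by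
  cases h with
  | ofD h => exact .ofD h
  | exL h => exact h

theorem IsS.of_allL {τ : Level} {F : Fml (n + 1) m} (h : (Fml.allL τ F).IsS) : F.IsS := by
  cases h with
  | ofD h => exact .ofD h
  | allL h => exact h

theorem IsS.of_ex {F : Fml (n + 1) m} (h : (Fml.ex F).IsS) : F.IsS := by
  cases h with
  | ofD h => exact absurd h id
  | ex h => exact h

theorem not_isS_all {F : Fml (n + 1) m} : ¬ (Fml.all F).IsS := by
  rintro (h | _); exact h

theorem not_isS_exR {F : Fml n (m + 1)} : ¬ (Fml.exR F).IsS := by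
  rintro (h | _); exact h

theorem not_isS_allR {F : Fml n (m + 1)} : ¬ (Fml.allR F).IsS := by
  rintro (h | _); exact h

theorem IsSigma.isS {F : Fml n m} (h : F.IsSigma) : F.IsS := by
  induction h with
  | ofDelta0 h => exact .ofD h.isD
  | or _ _ h₁ h₂ => exact .or h₁ h₂
  | and _ _ h₁ h₂ => exact .and h₁ h₂
  | bex _ h => exact .bex h
  | ball _ h => exact .ball h
  | ex _ h => exact .ex h

theorem IsS.isB_atLevel {F : Fml n m} (h : F.IsS) (β : Level) : (F.atLevel β).IsB := by
  induction h with
  | ofD h => rw [h.isB.atLevel_eq]; exact h.isB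
  | or _ _ h₁ h₂ => exact ⟨h₁, h₂⟩
  | and _ _ h₁ h₂ => exact ⟨h₁, h₂⟩
  | _ => assumption

theorem atLevel_subst (β : Level) (F : Fml n m) (s : Fin n → Term k) :
    (F.subst s).atLevel β = (F.atLevel β).subst s := by
  induction F generalizing k <;> simp_all [Fml.subst, Fml.atLevel]

theorem neg_subst (F : Fml n m) (s : Fin n → Term k) : (F.subst s).neg = F.neg.subst s := by
  induction F generalizing k <;> simp_all [Fml.subst, Fml.neg]

/-! ### Ranks -/

theorem Om_le_rank_of_quantifier (F : Fml n m) {P : Prop} [Decidable P] :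
    Om ≤ if P then Om else max (Om + 1) (F.rank + 3) := by
  split_ifs
  · exact le_rfl
  · exact le_max_of_le_left le_self_add

open Classical in
theorem isB_of_rank_lt {F : Fml n m} (h : F.rank < Om) : F.IsB := by
  induction F with
  | or F G hF hG | and F G hF hG =>
    have h' := (lt_add_one _).trans h
    exact ⟨hF ((le_max_left _ _).trans_lt h'), hG ((le_max_right _ _).trans_lt h')⟩
  | bex a F hF | ball a F hF | exL α F hF | allL α F hF =>
    exact hF (((le_max_right _ _).trans_lt (lt_add_one _)).trans ((lt_add_one _).trans h))
  | ex F hF | all F hF => exact absurd h (not_lt.2 (Om_le_rank_of_quantifier F))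
  | exR F hF | allR F hF => exact hF ((lt_add_one _).trans h)
  | _ => trivial

/-- The rank of a formula without unbounded set quantifiers is bounded by its parameters. -/
theorem IsB.rank_lt_psi {F : Fml n m} (h : F.IsB) {α : Ordinal.{0}}
    (hF : F.params ⊆ Iio (psi α)) : F.rank < psi α := by
  induction F with
  | mem | nmem | rel | nrel => exact zero_lt_psi α
  | lev | nlev => exact omega0_mul_lt_psi (hF rfl)
  | or F G ihF ihG | and F G ihF ihG =>
    rw [Fml.params, union_subset_iff] at hF
    exact add_one_lt_psi (max_lt (ihF h.1 hF.1) (ihG h.2 hF.2))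
  | bex a F ih | ball a F ih =>
    rw [Fml.params, union_subset_iff] at hF
    exact add_one_lt_psi (add_one_lt_psi (max_lt (zero_lt_psi α) (ih h hF.2)))
  | exL β F ih | allL β F ih =>
    rw [Fml.params, union_subset_iff] at hF
    exact add_one_lt_psi (add_one_lt_psi
      (max_lt (omega0_mul_lt_psi (hF.1 rfl)) (ih h hF.2)))
  | ex F ih | all F ih => exact absurd h id
  | exR F ih | allR F ih => exact add_one_lt_psi (ih h hF)

theorem add_one_ne_Om (α : Ordinal.{0}) : α + 1 ≠ Om := by
  intro h
  have h' : α < Om := h ▸ lt_add_one α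
  exact absurd h (isPrincipal_add_Om h' (one_lt_omega0.trans omega0_lt_Om)).ne

theorem isDelta0_of_quantifier_rank_eq {F : Fml n m} {P : Prop} [Decidable P]
    (h : (if P then Om else max (Om + 1) (F.rank + 3)) = Om) : P := by
  by_contra hP
  rw [if_neg hP] at h
  exact absurd ((le_max_left _ _).trans h.le) (not_le.2 (lt_add_one Om))

open Classical in
/-- The formulas of rank exactly `Ω` are `∃ x A` and `∀ x A` with `A` in `Δ₀`. -/
theorem eq_of_rank_eq_Om {F : Fml n m} (h : F.rank = Om) :
    ∃ A : Fml (n + 1) m, A.IsDelta0 ∧ (F = .ex A ∨ F = .all A) := by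
  cases F with
  | mem | nmem | rel | nrel => exact absurd h (omega_pos 1).ne
  | lev α a | nlev α a => exact absurd h (omega0_mul_lt_Om α.2.1).ne
  | ex A => exact ⟨A, isDelta0_of_quantifier_rank_eq h, .inl rfl⟩
  | all A => exact ⟨A, isDelta0_of_quantifier_rank_eq h, .inr rfl⟩
  | _ => exact absurd h (add_one_ne_Om _)

end Fml

/-! ### Axioms -/

/-- The active formulas of an axiom contain no unbounded set quantifier, and the remaining ones may
be replaced at will. -/
theorem IsAxiom.exists_active {Θ : Finset (Fml 0 0)} (h : IsAxiom Θ) :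
    ∃ Δ ⊆ Θ, (∀ F ∈ Δ, F.IsB) ∧ ∀ Θ' : Finset (Fml 0 0), Δ ⊆ Θ' → IsAxiom Θ' := by
  have key : ∀ {Γ Δ : Finset (Fml 0 0)}, (∀ F ∈ Δ, F.IsB) → (∀ Γ, IsAxiom (Γ ∪ Δ)) →
      ∃ Δ' ⊆ Γ ∪ Δ, (∀ F ∈ Δ', F.IsB) ∧ ∀ Θ' : Finset (Fml 0 0), Δ' ⊆ Θ' → IsAxiom Θ' :=
    fun {Γ Δ} hB hΔ => ⟨Δ, Finset.subset_union_right, hB, fun Θ' hΘ' => by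
      rw [← Finset.union_eq_left.2 hΘ']; exact hΔ Θ'⟩
  have hIff : ∀ {n m : ℕ} {F G : Fml n m}, F.IsB → G.IsB → (F.iff G).IsB :=
    fun hF hG => ⟨⟨hF.neg, hG⟩, hG.neg, hF⟩
  cases h with
  | tnd Γ F hF => exact key (by simp [hF, hF.neg]) fun Γ => .tnd Γ F hF
  | equality Γ a b F hF =>
    refine key ?_ fun Γ => .equality Γ a b F hF
    simp only [Finset.mem_insert, Finset.mem_singleton, forall_eq_or_imp, forall_eq]
    exact ⟨by simp [eqF, Fml.neg, Fml.IsB], (hF.subst _).neg, hF.subst _⟩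
  | subOmega Γ U a => exact key (by simp [Fml.IsB]) fun Γ => .subOmega Γ U a
  | levZero Γ a => exact key (by simp [Fml.IsB]) fun Γ => .levZero Γ a
  | levEmpty Γ => exact key (by simp [Fml.IsB]) fun Γ => .levEmpty Γ
  | emptySet Γ a => exact key (by simp [Fml.IsB]) fun Γ => .emptySet Γ a
  | levOmega Γ => exact key (by simp [Fml.IsB]) fun Γ => .levOmega Γ
  | infinity Γ a =>
    exact key (by simp [Fml.IsB, Fml.iff, Fml.imp, Fml.neg, finOrdF, ordF, tranF, succF, eqSuccF,
      eqF]) fun Γ => .infinity Γ a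
  | levMono Γ α β a h => exact key (by simp [Fml.IsB]) fun Γ => .levMono Γ α β a h
  | levMem Γ α a b => exact key (by simp [Fml.IsB]) fun Γ => .levMem Γ α a b
  | pair Γ α β a b h => exact key (by simp [Fml.IsB, pairF]) fun Γ => .pair Γ α β a b h
  | union Γ α a => exact key (by simp [Fml.IsB, unionF]) fun Γ => .union Γ α a
  | sep Γ α a A hA =>
    have h := hA.isD.isB
    exact key (by simp [Fml.IsB, sepF, Fml.imp, h.subst, (h.subst _).neg])
      fun Γ => .sep Γ α a A hA
  | comp Γ A hA =>
    have h : (Fml.wkR (.allR A) : Fml 1 1).IsB := Fml.IsB.substR (F := .allR A) hA.isD.isB _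
    refine key ?_ fun Γ => .comp Γ A hA
    simp only [Finset.mem_singleton, forall_eq]
    exact hIff (F := .rel (.bound 0) (.bound 0)) trivial h

/-! ### Control conditions -/

theorem params_union (Γ Δ : Finset (Fml 0 0)) : params (Γ ∪ Δ) = params Γ ∪ params Δ := by
  simp only [params, Finset.mem_union, iUnion_or, iUnion_union_distrib]

theorem params_mono {Γ Δ : Finset (Fml 0 0)} (h : Γ ⊆ Δ) : params Γ ⊆ params Δ :=
  biUnion_subset_biUnion_left h

theorem Fml.params_subset_params {F : Fml 0 0} {Γ : Finset (Fml 0 0)} (h : F ∈ Γ) :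
    F.params ⊆ RSStar.params Γ :=
  subset_biUnion_of_mem (u := Fml.params) (Finset.mem_coe.2 h)

theorem DerivesLt.controlled {p : ℕ∞} {ρ : Ordinal.{0}} {H : Operator} {α : Ordinal.{0}}
    {Θ : Finset (Fml 0 0)} (h : DerivesLt p ρ H α Θ) : Controlled p H α Θ := by
  cases h <;> assumption

namespace Controlled

variable {p : ℕ∞} {H H' : Operator} {α α' : Ordinal.{0}} {Γ Θ : Finset (Fml 0 0)}

theorem depth_mem (h : Controlled p H α Γ) : α ∈ H ∅ := h.1 (Or.inl rfl)

theorem params_subset (h : Controlled p H α Γ) : RSStar.params Γ ⊆ H ∅ :=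
  subset_union_right.trans h.1

theorem formula (h : Controlled p H α Γ) {F : Fml 0 0} (hF : F ∈ Γ) :
    F.params ⊆ H ∅ ∧ (F.length : ℕ∞) < p :=
  ⟨(Fml.params_subset_params hF).trans h.params_subset, h.2 F hF⟩

theorem of_forall (hα : α ∈ H ∅) (hΓ : ∀ F ∈ Γ, F.params ⊆ H ∅ ∧ (F.length : ℕ∞) < p) :
    Controlled p H α Γ :=
  ⟨union_subset (singleton_subset_iff.2 hα) (iUnion₂_subset fun F hF => (hΓ F hF).1),
    fun F hF => (hΓ F hF).2⟩

theorem union (h : Controlled p H' α' Γ) (hH : H' ∅ ⊆ H ∅) (hα : α ∈ H ∅)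
    {Δ : Finset (Fml 0 0)} (hΔ : ∀ F ∈ Δ, F.params ⊆ H ∅ ∧ (F.length : ℕ∞) < p) :
    Controlled p H α (Γ ∪ Δ) := by
  refine of_forall hα fun F hF => ?_
  rcases Finset.mem_union.1 hF with hF | hF
  · exact ⟨(h.formula hF).1.trans hH, (h.formula hF).2⟩
  · exact hΔ F hF

/-- The control conditions of a premise `Θ, Δ` survive replacing its context `Θ` by `Γ`. -/
theorem union_premise {H₀ : Operator} {Δ : Finset (Fml 0 0)} (h : Controlled p H' α' Γ)
    (hH : H' ∅ ⊆ H ∅) (hp : Controlled p H₀ α (Θ ∪ Δ)) (hH₀ : H₀ ∅ ⊆ H ∅) :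
    Controlled p H α (Γ ∪ Δ) :=
  h.union hH (hH₀ hp.depth_mem) fun _ hF =>
    have := hp.formula (Finset.mem_union_right Θ hF)
    ⟨this.1.trans hH₀, this.2⟩

end Controlled

/-! ### The rules, for a principal formula that is kept in the context -/

namespace DerivesLt

variable {p : ℕ∞} {ρ : Ordinal.{0}} {H : Operator} {α α₀ α₁ : Ordinal.{0}} {Γ : Finset (Fml 0 0)}

theorem or' {F G : Fml 0 0} (hP : .or F G ∈ Γ) (hα : α₀ < α) (h : DerivesLt p ρ H α₀ (Γ ∪ {F, G}))
    (hc : Controlled p H α Γ) : DerivesLt p ρ H α Γ := by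
  have e := Finset.union_eq_left.2 (Finset.singleton_subset_iff.2 hP)
  have := DerivesLt.or hα h (by rwa [e])
  rwa [e] at this

theorem and' {F G : Fml 0 0} (hP : .and F G ∈ Γ) (hα : α₀ < α) (hα' : α₁ < α)
    (h : DerivesLt p ρ H α₀ (Γ ∪ {F})) (h' : DerivesLt p ρ H α₁ (Γ ∪ {G}))
    (hc : Controlled p H α Γ) : DerivesLt p ρ H α Γ := by
  have e := Finset.union_eq_left.2 (Finset.singleton_subset_iff.2 hP)
  have := DerivesLt.and hα hα' h h' (by rwa [e])
  rwa [e] at this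

theorem nlev' {l : Level} {a : Term 0} (hP : .nlev l a ∈ Γ) (d : Level → Ordinal.{0})
    (hl : Order.IsSuccLimit l.1) (hd : ∀ β : Level, β < l → d β < α)
    (h : ∀ β : Level, β < l → DerivesLt p ρ (H.relativize {β.1}) (d β) (Γ ∪ {.nlev β a}))
    (hc : Controlled p H α Γ) : DerivesLt p ρ H α Γ := by
  have e := Finset.union_eq_left.2 (Finset.singleton_subset_iff.2 hP)
  have := DerivesLt.nlev d hl hd h (by rwa [e])
  rwa [e] at this

theorem ex' {F : Fml 1 0} {β : Level} {a : Term 0} (hP : .ex F ∈ Γ) (hα : α₀ < α) (hβ : β.1 < α)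
    (h : DerivesLt p ρ H α₀ (Γ ∪ {.and (.lev β a) (F.inst a)}))
    (hc : Controlled p H α Γ) : DerivesLt p ρ H α Γ := by
  have e := Finset.union_eq_left.2 (Finset.singleton_subset_iff.2 hP)
  have := DerivesLt.ex hα hβ h (by rwa [e])
  rwa [e] at this

theorem all' {F : Fml 1 0} (hP : .all F ∈ Γ) (d : Level → Ordinal.{0})
    (hd : ∀ β : Level, β.1 < d β ∧ d β < α)
    (h : ∀ (β : Level) (a : Term 0),
      DerivesLt p ρ (H.relativize {β.1}) (d β) (Γ ∪ {.or (.nlev β a) (F.inst a)}))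
    (hc : Controlled p H α Γ) : DerivesLt p ρ H α Γ := by
  have e := Finset.union_eq_left.2 (Finset.singleton_subset_iff.2 hP)
  have := DerivesLt.all d hd h (by rwa [e])
  rwa [e] at this

theorem exL' {τ : Level} {F : Fml 1 0} {β : Level} {a : Term 0} (hP : .exL τ F ∈ Γ) (hα : α₀ < α)
    (hβ : β ≤ τ) (h : DerivesLt p ρ H α₀ (Γ ∪ {.and (.lev β a) (F.inst a)}))
    (hc : Controlled p H α Γ) : DerivesLt p ρ H α Γ := by
  have e := Finset.union_eq_left.2 (Finset.singleton_subset_iff.2 hP)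
  have := DerivesLt.exL hα hβ h (by rwa [e])
  rwa [e] at this

theorem allL' {τ : Level} {F : Fml 1 0} (hP : .allL τ F ∈ Γ) (d : Level → Ordinal.{0})
    (hd : ∀ β : Level, β ≤ τ → d β < α)
    (h : ∀ (β : Level) (a : Term 0), β ≤ τ →
      DerivesLt p ρ (H.relativize {β.1}) (d β) (Γ ∪ {.or (.nlev β a) (F.inst a)}))
    (hc : Controlled p H α Γ) : DerivesLt p ρ H α Γ := by
  have e := Finset.union_eq_left.2 (Finset.singleton_subset_iff.2 hP)
  have := DerivesLt.allL d hd h (by rwa [e])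
  rwa [e] at this

theorem bex' {a b : Term 0} {F : Fml 1 0} (hP : .bex a F ∈ Γ) (hα : α₀ < α)
    (h : DerivesLt p ρ H α₀ (Γ ∪ {.and (.mem b a) (F.inst b)}))
    (hc : Controlled p H α Γ) : DerivesLt p ρ H α Γ := by
  have e := Finset.union_eq_left.2 (Finset.singleton_subset_iff.2 hP)
  have := DerivesLt.bex hα h (by rwa [e])
  rwa [e] at this

theorem ball' {a : Term 0} {F : Fml 1 0} (hP : .ball a F ∈ Γ) (hα : α₀ < α)
    (h : ∀ b : Term 0, DerivesLt p ρ H α₀ (Γ ∪ {.or (.nmem b a) (F.inst b)}))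
    (hc : Controlled p H α Γ) : DerivesLt p ρ H α Γ := by
  have e := Finset.union_eq_left.2 (Finset.singleton_subset_iff.2 hP)
  have := DerivesLt.ball hα h (by rwa [e])
  rwa [e] at this

theorem exR' {F : Fml 0 1} {U : RVar 0} (hP : .exR F ∈ Γ) (hα : α₀ < α)
    (h : DerivesLt p ρ H α₀ (Γ ∪ {F.instR U}))
    (hc : Controlled p H α Γ) : DerivesLt p ρ H α Γ := by
  have e := Finset.union_eq_left.2 (Finset.singleton_subset_iff.2 hP)
  have := DerivesLt.exR hα h (by rwa [e])
  rwa [e] at this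

theorem allR' {F : Fml 0 1} (hP : .allR F ∈ Γ) (hα : α₀ < α)
    (h : ∀ U : RVar 0, DerivesLt p ρ H α₀ (Γ ∪ {F.instR U}))
    (hc : Controlled p H α Γ) : DerivesLt p ρ H α Γ := by
  have e := Finset.union_eq_left.2 (Finset.singleton_subset_iff.2 hP)
  have := DerivesLt.allR hα h (by rwa [e])
  rwa [e] at this

theorem ref' {F : Fml 0 0} (hP : .ex (F.wk.restrict (.bound 0)) ∈ Γ) (hα : α₀ < α)
    (hΩ : Om < α) (hF : F.IsS0) (h : DerivesLt p ρ H α₀ (Γ ∪ {F}))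
    (hc : Controlled p H α Γ) : DerivesLt p ρ H α Γ := by
  have e := Finset.union_eq_left.2 (Finset.singleton_subset_iff.2 hP)
  have := DerivesLt.ref hα hΩ hF h (by rwa [e])
  rwa [e] at this

theorem bc' {F : Fml 0 0} {β : Level}
    (hP : .exL (β.add Level.omega) (F.wk.restrict (.bound 0)) ∈ Γ) (hα : α₀ < α)
    (hF : F.IsS0) (h : DerivesLt p ρ H α₀ (Γ ∪ {F.atLevel β}))
    (hc : Controlled p H α Γ) : DerivesLt p ρ H α Γ := by
  have e := Finset.union_eq_left.2 (Finset.singleton_subset_iff.2 hP)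
  have := DerivesLt.bc hα hF h (by rwa [e])
  rwa [e] at this

/-! ### Structural lemmas -/

theorem relativize_le {H H' : Operator} (hH : H ≤ H') (s : Set Ordinal.{0}) :
    H.relativize s ≤ H'.relativize s := fun X => hH (s ∪ X)

theorem subset_relativize {H : Operator} (hH : Monotone H) (s : Set Ordinal.{0}) :
    H ∅ ⊆ H.relativize s ∅ := hH (empty_subset _)

/-- Weakening, combined with inversion for unbounded universal quantifiers: every formula `∀ x A`
of the sequent may be replaced by `∀ x^τ A`, the premises for levels above `τ` being dropped. -/
theorem weaken_all {ρ' : Ordinal.{0}} {Θ : Finset (Fml 0 0)} (τ : Level)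
    (h : DerivesLt p ρ H α Θ) (hρ : ρ ≤ ρ') {H' : Operator} {α' : Ordinal.{0}}
    {Γ : Finset (Fml 0 0)} (hH' : Monotone H') (hH : H ≤ H') (hα : α ≤ α')
    (hc : Controlled p H' α' Γ)
    (hΓ : ∀ F ∈ Θ, F ∈ Γ ∨ ∃ A, F = .all A ∧ .allL τ A ∈ Γ) :
    DerivesLt p ρ' H' α' Γ := by
  -- The replacement condition passes from a conclusion `Θ, P` to a premise `Θ, Δ`.
  have mem : ∀ {Θ Γ Δ P : Finset (Fml 0 0)},
      (∀ F ∈ Θ ∪ P, F ∈ Γ ∨ ∃ A, F = .all A ∧ .allL τ A ∈ Γ) →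
      ∀ F ∈ Θ ∪ Δ, F ∈ Γ ∪ Δ ∨ ∃ A, F = .all A ∧ .allL τ A ∈ Γ ∪ Δ := by
    intro Θ Γ Δ P h F hF
    rcases Finset.mem_union.1 hF with hF | hF
    · rcases h F (Finset.mem_union_left _ hF) with h | ⟨A, h, h'⟩
      · exact .inl (Finset.mem_union_left _ h)
      · exact .inr ⟨A, h, Finset.mem_union_left _ h'⟩
    · exact .inl (Finset.mem_union_right _ hF)
  -- A principal formula other than `∀ x A` has to be kept.
  have principal : ∀ {Θ Γ : Finset (Fml 0 0)} {P : Fml 0 0},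
      (∀ F ∈ Θ ∪ {P}, F ∈ Γ ∨ ∃ A, F = .all A ∧ .allL τ A ∈ Γ) →
      (∀ A, P ≠ .all A) → P ∈ Γ := by
    intro Θ Γ P h hP
    rcases h P (by simp) with h | ⟨A, h, -⟩
    · exact h
    · exact absurd h (hP A)
  induction h generalizing H' α' Γ with
  | ax hax =>
    obtain ⟨Δ, hΔ, hB, hax⟩ := hax.exists_active
    refine .ax (hax _ fun F hF => ?_) hc
    rcases hΓ F (hΔ hF) with h | ⟨A, rfl, -⟩
    · exact h
    · exact absurd (hB _ hF) id
  | or hlt h _ ih =>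
    exact or' (principal hΓ (by simp)) (hlt.trans_le hα) (ih hH' hH le_rfl
      (hc.union_premise subset_rfl h.controlled (hH ∅)) (mem hΓ)) hc
  | and hlt hlt' h h' _ ih ih' =>
    exact and' (principal hΓ (by simp)) (hlt.trans_le hα) (hlt'.trans_le hα)
      (ih hH' hH le_rfl (hc.union_premise subset_rfl h.controlled (hH ∅)) (mem hΓ))
      (ih' hH' hH le_rfl (hc.union_premise subset_rfl h'.controlled (hH ∅)) (mem hΓ)) hc
  | nlev d hl hd h _ ih =>
    exact nlev' (principal hΓ (by simp)) d hl (fun β hβ => (hd β hβ).trans_le hα)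
      (fun β hβ => ih β hβ (hH'.relativize _) (relativize_le hH _) le_rfl
        (hc.union_premise (subset_relativize hH' _) (h β hβ).controlled (relativize_le hH _ ∅))
        (mem hΓ)) hc
  | ex hlt hβ h _ ih =>
    exact ex' (principal hΓ (by simp)) (hlt.trans_le hα) (hβ.trans_le hα) (ih hH' hH le_rfl
      (hc.union_premise subset_rfl h.controlled (hH ∅)) (mem hΓ)) hc
  | @all H α Θ F d hd h _ ih =>
    have h' := fun β a => ih β a (hH'.relativize _) (relativize_le hH _) le_rfl
      (hc.union_premise (subset_relativize hH' _) (h β a).controlled (relativize_le hH _ ∅))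
      (mem hΓ)
    rcases hΓ (.all F) (by simp) with hP | ⟨A, hA, hP⟩
    · exact all' hP d (fun β => ⟨(hd β).1, (hd β).2.trans_le hα⟩) h' hc
    · cases hA
      exact allL' hP d (fun β _ => (hd β).2.trans_le hα) (fun β a _ => h' β a) hc
  | exL hlt hβ h _ ih =>
    exact exL' (principal hΓ (by simp)) (hlt.trans_le hα) hβ (ih hH' hH le_rfl
      (hc.union_premise subset_rfl h.controlled (hH ∅)) (mem hΓ)) hc
  | allL d hd h _ ih =>
    exact allL' (principal hΓ (by simp)) d (fun β hβ => (hd β hβ).trans_le hα)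
      (fun β a hβ => ih β a hβ (hH'.relativize _) (relativize_le hH _) le_rfl
        (hc.union_premise (subset_relativize hH' _) (h β a hβ).controlled (relativize_le hH _ ∅))
        (mem hΓ)) hc
  | bex hlt h _ ih =>
    exact bex' (principal hΓ (by simp)) (hlt.trans_le hα) (ih hH' hH le_rfl
      (hc.union_premise subset_rfl h.controlled (hH ∅)) (mem hΓ)) hc
  | ball hlt h _ ih =>
    exact ball' (principal hΓ (by simp)) (hlt.trans_le hα) (fun b => ih b hH' hH le_rfl
      (hc.union_premise subset_rfl (h b).controlled (hH ∅)) (mem hΓ)) hc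
  | exR hlt h _ ih =>
    exact exR' (principal hΓ (by simp)) (hlt.trans_le hα) (ih hH' hH le_rfl
      (hc.union_premise subset_rfl h.controlled (hH ∅)) (mem hΓ)) hc
  | allR hlt h _ ih =>
    exact allR' (principal hΓ (by simp)) (hlt.trans_le hα) (fun U => ih U hH' hH le_rfl
      (hc.union_premise subset_rfl (h U).controlled (hH ∅)) (mem hΓ)) hc
  | @cut H α α₀ Θ F hlt hr hl h h' _ ih ih' =>
    rw [← Finset.union_empty Θ] at hΓ
    exact .cut (hlt.trans_le hα) (hr.trans_le hρ) hl
      (ih hH' hH le_rfl (hc.union_premise subset_rfl h.controlled (hH ∅)) (mem hΓ))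
      (ih' hH' hH le_rfl (hc.union_premise subset_rfl h'.controlled (hH ∅)) (mem hΓ)) hc
  | ref hlt hΩ hF h _ ih =>
    exact ref' (principal hΓ (by simp)) (hlt.trans_le hα) (hΩ.trans_le hα) hF (ih hH' hH le_rfl
      (hc.union_premise subset_rfl h.controlled (hH ∅)) (mem hΓ)) hc
  | bc hlt hF h _ ih =>
    exact bc' (principal hΓ (by simp)) (hlt.trans_le hα) hF (ih hH' hH le_rfl
      (hc.union_premise subset_rfl h.controlled (hH ∅)) (mem hΓ)) hc

theorem weaken {ρ' : Ordinal.{0}} {Θ : Finset (Fml 0 0)}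
    (h : DerivesLt p ρ H α Θ) (hρ : ρ ≤ ρ') {H' : Operator} {α' : Ordinal.{0}}
    {Γ : Finset (Fml 0 0)} (hH' : Monotone H') (hH : H ≤ H') (hα : α ≤ α')
    (hc : Controlled p H' α' Γ) (hΓ : Θ ⊆ Γ) : DerivesLt p ρ' H' α' Γ :=
  h.weaken_all Level.zero hρ hH' hH hα hc fun _ hF => .inl (hΓ hF)

/-! ### Boundedness -/

/-- In a derivation of depth at most `β < Ω` the witnesses of unbounded existential quantifiers have
level below `β` and reflection is not used. Hence any formulas `F` of the sequent that lie in the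
class `𝓢` may be replaced by `F^β`. -/
theorem boundedness {Θ : Finset (Fml 0 0)} {β : Level}
    (h : DerivesLt p ρ H α Θ) {Γ : Finset (Fml 0 0)} (hH : Monotone H) (hβ : β.1 ∈ H ∅)
    (hα : α ≤ β.1) (hc : Controlled p H α Γ)
    (hΓ : ∀ F ∈ Θ, F ∈ Γ ∨ F.IsS ∧ F.atLevel β ∈ Γ) : DerivesLt p ρ H α Γ := by
  -- The replacement condition passes from a conclusion `Θ, P` to a premise `Θ, Δ` whose side
  -- formulas `Δ` are replaced by `Δ'`.
  have mem : ∀ {Θ Γ Δ Δ' P : Finset (Fml 0 0)}, (∀ F ∈ Θ ∪ P, F ∈ Γ ∨ F.IsS ∧ F.atLevel β ∈ Γ) →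
      (∀ F ∈ Δ, F ∈ Δ' ∨ F.IsS ∧ F.atLevel β ∈ Δ') →
      ∀ F ∈ Θ ∪ Δ, F ∈ Γ ∪ Δ' ∨ F.IsS ∧ F.atLevel β ∈ Γ ∪ Δ' := by
    intro Θ Γ Δ Δ' P h h' F hF
    rcases Finset.mem_union.1 hF with hF | hF
    · rcases h F (Finset.mem_union_left _ hF) with h | ⟨h, h'⟩
      · exact .inl (Finset.mem_union_left _ h)
      · exact .inr ⟨h, Finset.mem_union_left _ h'⟩
    · rcases h' F hF with h | ⟨h, h'⟩
      · exact .inl (Finset.mem_union_right _ h)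
      · exact .inr ⟨h, Finset.mem_union_right _ h'⟩
  have keep : ∀ {Δ : Finset (Fml 0 0)}, ∀ F ∈ Δ, F ∈ Δ ∨ F.IsS ∧ F.atLevel β ∈ Δ :=
    fun _ hF => .inl hF
  have one : ∀ {F G : Fml 0 0}, F.IsS → F.atLevel β = G → ∀ F' ∈ ({F} : Finset (Fml 0 0)),
      F' ∈ ({G} : Finset (Fml 0 0)) ∨ F'.IsS ∧ F'.atLevel β ∈ ({G} : Finset (Fml 0 0)) := by
    rintro F _ h rfl F' hF'
    rw [Finset.mem_singleton.1 hF']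
    exact .inr ⟨h, Finset.mem_singleton_self _⟩
  have bounded : ∀ {H H₁ : Operator} {α₀ α : Ordinal.{0}} {Θ Γ Δ : Finset (Fml 0 0)},
      β.1 ∈ H ∅ → H ∅ ⊆ H₁ ∅ → Controlled p H α Γ → Controlled p H₁ α₀ (Θ ∪ Δ) →
      Controlled p H₁ α₀ (Γ ∪ Δ.image (Fml.atLevel β)) := by
    intro H H₁ α₀ α Θ Γ Δ hβ hH hc hp
    refine hc.union hH hp.depth_mem fun F hF => ?_
    obtain ⟨G, hG, rfl⟩ := Finset.mem_image.1 hF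
    have := hp.formula (Finset.mem_union_right Θ hG)
    exact ⟨(G.params_atLevel β).trans (union_subset (singleton_subset_iff.2 (hH hβ)) this.1),
      by simpa using this.2⟩
  -- A principal formula outside `𝓢` is kept, and one in `𝓑` is not changed by `F ↦ F^β`.
  have principal : ∀ {Θ Γ : Finset (Fml 0 0)} {P : Fml 0 0},
      (∀ F ∈ Θ ∪ {P}, F ∈ Γ ∨ F.IsS ∧ F.atLevel β ∈ Γ) →
      (¬ P.IsS ∨ P.IsB) → P ∈ Γ := by
    intro Θ Γ P h hP
    rcases h P (by simp) with h | ⟨h, h'⟩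
    · exact h
    · exact (hP.resolve_left (not_not_intro h)).atLevel_eq β ▸ h'
  induction h generalizing Γ with
  | ax hax =>
    obtain ⟨Δ, hΔ, hB, hax⟩ := hax.exists_active
    refine .ax (hax _ fun F hF => ?_) hc
    rcases hΓ F (hΔ hF) with h | ⟨-, h⟩
    · exact h
    · rwa [(hB F hF).atLevel_eq] at h
  | @or H α α₀ Θ F G hlt h _ ih =>
    have ih := @ih
    rcases hΓ (.or F G) (by simp) with hP | ⟨hS, hP⟩
    · exact or' hP hlt (ih hH hβ (hlt.le.trans hα)
        (hc.union_premise subset_rfl h.controlled subset_rfl) (mem hΓ keep)) hc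
    · refine or' hP hlt (ih hH hβ (hlt.le.trans hα) ?_ (mem hΓ ?_)) hc
      · simpa using bounded hβ subset_rfl hc h.controlled
      · have := hS.of_or
        simp [this]
  | @and H α α₀ α₁ Θ F G hlt hlt' h h' _ ih ih' =>
    rcases hΓ (.and F G) (by simp) with hP | ⟨hS, hP⟩
    · exact and' hP hlt hlt' (ih hH hβ (hlt.le.trans hα)
        (hc.union_premise subset_rfl h.controlled subset_rfl) (mem hΓ keep))
        (ih' hH hβ (hlt'.le.trans hα)
        (hc.union_premise subset_rfl h'.controlled subset_rfl) (mem hΓ keep)) hc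
    · exact and' hP hlt hlt' (ih hH hβ (hlt.le.trans hα)
        (by simpa using bounded hβ subset_rfl hc h.controlled) (mem hΓ (one hS.of_and.1 rfl)))
        (ih' hH hβ (hlt'.le.trans hα)
        (by simpa using bounded hβ subset_rfl hc h'.controlled) (mem hΓ (one hS.of_and.2 rfl))) hc
  | nlev d hl hd h _ ih =>
    exact nlev' (principal hΓ (.inr trivial)) d hl hd
      (fun γ hγ => ih γ hγ (hH.relativize _) (subset_relativize hH _ hβ) ((hd γ hγ).le.trans hα)
        (hc.union_premise (subset_relativize hH _) (h γ hγ).controlled subset_rfl)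
        (mem hΓ keep)) hc
  | @ex H α α₀ Θ F γ a hlt hγ h _ ih =>
    rcases hΓ (.ex F) (by simp) with hP | ⟨hS, hP⟩
    · exact ex' hP hlt hγ (ih hH hβ (hlt.le.trans hα)
        (hc.union_premise subset_rfl h.controlled subset_rfl) (mem hΓ keep)) hc
    · have e : (Fml.and (.lev γ a) (F.inst a)).atLevel β =
          .and (.lev γ a) ((F.atLevel β).inst a) := by
        simp [Fml.atLevel, Fml.inst, Fml.atLevel_subst]
      exact exL' hP hlt (hγ.le.trans hα) (ih hH hβ (hlt.le.trans hα)
        (by simpa [e] using bounded hβ subset_rfl hc h.controlled)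
        (mem hΓ (one (.and (.ofD trivial) (hS.of_ex.subst _)) e))) hc
  | all d hd h _ ih =>
    exact all' (principal hΓ (.inl Fml.not_isS_all)) d hd
      (fun γ a => ih γ a (hH.relativize _) (subset_relativize hH _ hβ) ((hd γ).2.le.trans hα)
        (hc.union_premise (subset_relativize hH _) (h γ a).controlled subset_rfl)
        (mem hΓ keep)) hc
  | @exL H α α₀ Θ τ F γ a hlt hγ h _ ih =>
    rcases hΓ (.exL τ F) (by simp) with hP | ⟨hS, hP⟩
    · exact exL' hP hlt hγ (ih hH hβ (hlt.le.trans hα)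
        (hc.union_premise subset_rfl h.controlled subset_rfl) (mem hΓ keep)) hc
    · have e : (Fml.and (.lev γ a) (F.inst a)).atLevel β =
          .and (.lev γ a) ((F.atLevel β).inst a) := by
        simp [Fml.atLevel, Fml.inst, Fml.atLevel_subst]
      exact exL' hP hlt hγ (ih hH hβ (hlt.le.trans hα)
        (by simpa [e] using bounded hβ subset_rfl hc h.controlled)
        (mem hΓ (one (.and (.ofD trivial) (hS.of_exL.subst _)) e))) hc
  | @allL H α Θ τ F d hd h _ ih =>
    rcases hΓ (.allL τ F) (by simp) with hP | ⟨hS, hP⟩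
    · exact allL' hP d hd (fun γ a hγ => ih γ a hγ (hH.relativize _) (subset_relativize hH _ hβ)
        ((hd γ hγ).le.trans hα)
        (hc.union_premise (subset_relativize hH _) (h γ a hγ).controlled subset_rfl)
        (mem hΓ keep)) hc
    · have e : ∀ (γ : Level) a, (Fml.or (.nlev γ a) (F.inst a)).atLevel β =
          .or (.nlev γ a) ((F.atLevel β).inst a) := by
        simp [Fml.atLevel, Fml.inst, Fml.atLevel_subst]
      exact allL' hP d hd (fun γ a hγ => ih γ a hγ (hH.relativize _) (subset_relativize hH _ hβ)
        ((hd γ hγ).le.trans hα)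
        (by simpa [e] using bounded hβ (subset_relativize hH _) hc (h γ a hγ).controlled)
        (mem hΓ (one (.or (.ofD trivial) (hS.of_allL.subst _)) (e γ a)))) hc
  | @bex H α α₀ Θ a F b hlt h _ ih =>
    rcases hΓ (.bex a F) (by simp) with hP | ⟨hS, hP⟩
    · exact bex' hP hlt (ih hH hβ (hlt.le.trans hα)
        (hc.union_premise subset_rfl h.controlled subset_rfl) (mem hΓ keep)) hc
    · have e : (Fml.and (.mem b a) (F.inst b)).atLevel β =
          .and (.mem b a) ((F.atLevel β).inst b) := by
        simp [Fml.atLevel, Fml.inst, Fml.atLevel_subst]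
      exact bex' hP hlt (ih hH hβ (hlt.le.trans hα)
        (by simpa [e] using bounded hβ subset_rfl hc h.controlled)
        (mem hΓ (one (.and (.ofD trivial) (hS.of_bex.subst _)) e))) hc
  | @ball H α α₀ Θ a F hlt h _ ih =>
    rcases hΓ (.ball a F) (by simp) with hP | ⟨hS, hP⟩
    · exact ball' hP hlt (fun b => ih b hH hβ (hlt.le.trans hα)
        (hc.union_premise subset_rfl (h b).controlled subset_rfl) (mem hΓ keep)) hc
    · have e : ∀ b, (Fml.or (.nmem b a) (F.inst b)).atLevel β =
          .or (.nmem b a) ((F.atLevel β).inst b) := by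
        simp [Fml.atLevel, Fml.inst, Fml.atLevel_subst]
      exact ball' hP hlt (fun b => ih b hH hβ (hlt.le.trans hα)
        (by simpa [e] using bounded hβ subset_rfl hc (h b).controlled)
        (mem hΓ (one (.or (.ofD trivial) (hS.of_ball.subst _)) (e b)))) hc
  | exR hlt h _ ih =>
    exact exR' (principal hΓ (.inl Fml.not_isS_exR)) hlt (ih hH hβ (hlt.le.trans hα)
      (hc.union_premise subset_rfl h.controlled subset_rfl) (mem hΓ keep)) hc
  | allR hlt h _ ih =>
    exact allR' (principal hΓ (.inl Fml.not_isS_allR)) hlt (fun U => ih U hH hβ (hlt.le.trans hα)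
      (hc.union_premise subset_rfl (h U).controlled subset_rfl) (mem hΓ keep)) hc
  | @cut H α α₀ Θ F hlt hr hl h h' _ ih ih' =>
    rw [← Finset.union_empty Θ] at hΓ
    exact .cut hlt hr hl
      (ih hH hβ (hlt.le.trans hα)
        (hc.union_premise subset_rfl h.controlled subset_rfl) (mem hΓ keep))
      (ih' hH hβ (hlt.le.trans hα)
        (hc.union_premise subset_rfl h'.controlled subset_rfl) (mem hΓ keep)) hc
  | ref hlt hΩ => exact absurd (hΩ.trans_le hα) (not_lt.2 β.2.1.le)
  | bc hlt hF h _ ih =>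
    exact bc' (principal hΓ (.inr (Fml.isB_restrict _ _))) hlt hF (ih hH hβ (hlt.le.trans hα)
      (hc.union_premise subset_rfl h.controlled subset_rfl) (mem hΓ keep)) hc

end DerivesLt

/-! ### Persistence -/

theorem relativize_empty_apply (H : Operator) (s : Set Ordinal.{0}) :
    H.relativize s ∅ = H s := congrArg H (union_empty s)

theorem relativize_empty (H : Operator) : H.relativize ∅ = H :=
  funext fun X => congrArg H (empty_union X)

theorem IsAxiom.of_neg_mem_of_mem {Θ : Finset (Fml 0 0)} {F : Fml 0 0} (hF : F.IsB)
    (h : F.neg ∈ Θ) (h' : F ∈ Θ) : IsAxiom Θ := by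
  have := IsAxiom.tnd Θ F hF
  rwa [Finset.union_eq_left.2 (Finset.insert_subset h (Finset.singleton_subset_iff.2 h'))] at this

theorem IsAxiom.of_nlev_mem_of_lev_mem {Θ : Finset (Fml 0 0)} {α : Level} {a : Term 0}
    (h : .nlev α a ∈ Θ) (h' : .lev α a ∈ Θ) : IsAxiom Θ :=
  IsAxiom.of_neg_mem_of_mem (F := .lev α a) trivial h h'

/-- `∃ x^τ B` implies `∃ x B`, by a cut against a derivation of `∀ x^τ ¬B, ∃ x B` from the
axioms. -/
theorem DerivesLt.ex_of_exL {p : ℕ∞} {ρ κ α₀ α : Ordinal.{0}} {s : Set Ordinal.{0}}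
    {Γ : Finset (Fml 0 0)} {B : Fml 1 0} {τ : Level} (hB : B.IsB) (hτ₀ : 0 < τ.1)
    (hP : .ex B ∈ Γ)
    (h : DerivesLt p ρ ((Hop κ).relativize s) α₀ (Γ ∪ {.exL τ B}))
    (hr : (Fml.exL τ B).rank < ρ) (hα₀ : α₀ ≤ τ.1 + 1 + 1 + 1) (hα : τ.1 + 1 + 1 + 1 < α)
    (hc : Controlled p ((Hop κ).relativize s) α Γ) :
    DerivesLt p ρ ((Hop κ).relativize s) α Γ := by
  have hm : Monotone ((Hop κ).relativize s) := (Hop_mono κ).relativize s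
  obtain ⟨hBp, hBl⟩ := hc.formula hP
  change B.params ⊆ _ at hBp
  change ((B.length + 1 : ℕ) : ℕ∞) < p at hBl
  have hBl' : ((B.length : ℕ) : ℕ∞) < p := lt_of_le_of_lt (by exact_mod_cast Nat.le_succ _) hBl
  have hp0 : ((0 : ℕ) : ℕ∞) < p := lt_of_le_of_lt (by simp) hBl
  have hτ : τ.1 ∈ (Hop κ).relativize s ∅ :=
    (h.controlled.formula (F := .exL τ B) (by simp)).1 (Or.inl rfl)
  have hall : (Fml.allL τ B.neg).params ⊆ (Hop κ).relativize s ∅ ∧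
      (((Fml.allL τ B.neg).length : ℕ) : ℕ∞) < p := by
    simp only [Fml.params, Fml.length, Fml.params_neg, Fml.length_neg]
    exact ⟨union_subset (singleton_subset_iff.2 hτ) hBp, hBl⟩
  have h1 : ∀ {X : Set Ordinal.{0}} {ξ : Ordinal.{0}}, ξ ∈ Hop κ X → ξ + 1 ∈ Hop κ X :=
    fun h => add_mem_Hop h (one_mem_Hop _ _)
  have hd := hc.union subset_rfl (h1 (h1 (h1 hτ)))
    (Δ := {Fml.allL τ B.neg}) (by simpa using! hall)
  refine .cut hα hr (h.controlled.formula (by simp)).2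
    (h.weaken le_rfl hm le_rfl hα₀
      (hc.union_premise subset_rfl ⟨?_, h.controlled.2⟩ subset_rfl) subset_rfl) ?_ hc
  · exact union_subset (singleton_subset_iff.2 (h1 (h1 (h1 hτ)))) h.controlled.params_subset
  refine DerivesLt.allL' (τ := τ) (F := B.neg) (Finset.mem_union_right _ (by simp [Fml.neg]))
    (fun _ => τ.1 + 1 + 1) (fun _ _ => lt_add_one _) (fun γ a hγ => ?_) hd
  -- The depths `τ`, `τ + 1`, `τ + 2` belong to `M_γ(a) ∧ B[a]`, to the following `∃ x B` (whose
  -- depth must exceed `γ ≤ τ`), and to `¬M_γ(a) ∨ ¬B[a]`.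
  have hs := DerivesLt.subset_relativize hm {γ.1}
  have hγm : γ.1 ∈ ((Hop κ).relativize s).relativize {γ.1} ∅ :=
    subset_Hop κ _ (by simp)
  have hτ' := hs hτ
  have hlev : ({γ.1} : Set Ordinal.{0}) ⊆ ((Hop κ).relativize s).relativize {γ.1} ∅ ∧
      ((0 : ℕ) : ℕ∞) < p := ⟨singleton_subset_iff.2 hγm, hp0⟩
  have hinst : ∀ {A : Fml 1 0}, A.params = B.params → A.length = B.length →
      (A.inst a).params ⊆ ((Hop κ).relativize s).relativize {γ.1} ∅ ∧
        (((A.inst a).length : ℕ) : ℕ∞) < p := by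
    intro A hA hA'
    simp only [Fml.inst, Fml.params_subst, Fml.length_subst, hA, hA']
    exact ⟨hBp.trans hs, hBl'⟩
  have hn := hinst (A := B.neg) (by simp) (by simp)
  have hb := hinst (A := B) rfl rfl
  have hn' : ((B.neg.inst a).length : ℕ) = B.length := by simp [Fml.inst]
  have hb' : ((B.inst a).length : ℕ) = B.length := by simp [Fml.inst]
  have hc₁ := hd.union hs (h1 (h1 hτ')) (Δ := {Fml.or (.nlev γ a) (B.neg.inst a)}) (by
    simp only [Finset.mem_singleton, forall_eq, Fml.params, Fml.length, hn', Nat.zero_max]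
    exact ⟨union_subset hlev.1 hn.1, hBl⟩)
  have hc₂ := hc₁.union subset_rfl (h1 hτ') (Δ := {Fml.nlev γ a, B.neg.inst a}) (by
    simp only [Finset.mem_insert, Finset.mem_singleton, forall_eq_or_imp, forall_eq]
    exact ⟨hlev, hn⟩)
  have hc₃ := hc₂.union subset_rfl hτ'
    (Δ := {Fml.and (.lev γ a) (B.inst a)}) (by
    simp only [Finset.mem_singleton, forall_eq, Fml.params, Fml.length, hb', Nat.zero_max]
    exact ⟨union_subset hlev.1 hb.1, hBl⟩)
  refine DerivesLt.or' (Finset.mem_union_right _ (Finset.mem_singleton_self _))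
    (lt_add_one _) ?_ hc₁
  refine DerivesLt.ex' (F := B) (β := γ) (a := a) (by simp [hP])
    (lt_add_one _) (lt_of_le_of_lt (Subtype.coe_le_coe.2 hγ) (lt_add_one _)) ?_ hc₂
  refine DerivesLt.and' (Finset.mem_union_right _ (Finset.mem_singleton_self _)) hτ₀ hτ₀
    (.ax ?_ (hc₃.union subset_rfl (zero_mem_Hop _ _) (by
      rintro _ hF; rw [Finset.mem_singleton.1 hF]; exact hlev)))
    (.ax ?_ (hc₃.union subset_rfl (zero_mem_Hop _ _) (by
      rintro _ hF; rw [Finset.mem_singleton.1 hF]; exact hb))) hc₃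
  · exact IsAxiom.of_nlev_mem_of_lev_mem (α := γ) (a := a) (by simp) (by simp)
  · exact IsAxiom.of_neg_mem_of_mem (F := B.inst a) (hB.subst _)
      (by simp [Fml.inst, Fml.neg_subst]) (by simp)

/-! ### Collapsing -/

/-- The hypotheses of the collapsing theorem on the sequent `Γ` and the index `σ` of the
controlling operator `H_σ[Γ]`. -/
structure Collapsible (σ : Ordinal.{0}) (Γ : Finset (Fml 0 0)) : Prop where
  class_mem : ∀ F ∈ Γ, F.IsS ∨ F.IsB
  params_subset : params Γ ⊆ C (σ + 1) (psi (σ + 1))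
  index_mem : σ ∈ Hop σ (params Γ)

theorem params_subset_level (Γ : Finset (Fml 0 0)) : params Γ ⊆ Iio Om ∩ C epsOm 0 :=
  iUnion₂_subset fun F _ => F.params_subset_level

variable {σ : Ordinal.{0}} {Γ : Finset (Fml 0 0)}

theorem Collapsible.Hop_subset (h : Collapsible σ Γ) {s : Set Ordinal.{0}}
    (hs : s ⊆ C (σ + 1) (psi (σ + 1))) :
    Hop σ (params Γ ∪ s) ⊆ C (σ + 1) (psi (σ + 1)) := fun _ hξ =>
  mem_Hop.1 hξ _ _ (union_subset h.params_subset hs) (lt_add_one σ)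

/-- Since `σ` belongs to `C(α, 0)` for a suitable `α`, it lies below `ε_{Ω+1}`. -/
theorem Collapsible.index_lt (h : Collapsible σ Γ) : σ < epsOm :=
  C_zero_lt_epsOm (α := max (σ + 1) epsOm) (mem_Hop.1 h.index_mem _ 0
    ((params_subset_level Γ).trans (inter_subset_right.trans (C_mono (le_max_right _ _) le_rfl)))
    ((lt_add_one σ).trans_le (le_max_left _ _)))

/-- The values of `ψ` used as depths in the collapsing theorem are levels. -/
theorem Collapsible.psi_hat_level (h : Collapsible σ Γ) {α : Ordinal.{0}}
    (hα : α ∈ Hop σ (params Γ)) : psi (hat σ α) < Om ∧ psi (hat σ α) ∈ C epsOm 0 := by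
  have hm := mem_Hop.1 (hat_mem_Hop h.index_mem hα) epsOm 0
    ((params_subset_level Γ).trans inter_subset_right) h.index_lt
  exact ⟨psi_lt_Om _, psi_mem_C (C_zero_lt_epsOm hm) hm⟩

theorem C_succ_subset_C_hat (σ α : Ordinal.{0}) :
    C (σ + 1) (psi (σ + 1)) ⊆ C (hat σ α) (psi (hat σ α)) :=
  C_mono (Order.add_one_le_of_lt (lt_hat σ α)) (psi_mono (Order.add_one_le_of_lt (lt_hat σ α)))

theorem lt_psi_hat {ξ : Ordinal.{0}} (hξ : ξ ∈ C (σ + 1) (psi (σ + 1))) (h : ξ < Om)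
    (α : Ordinal.{0}) : ξ < psi (hat σ α) :=
  lt_psi_of_mem (C_succ_subset_C_hat σ α hξ) h

theorem Collapsible.psi_hat_lt (h : Collapsible σ Γ) {s : Set Ordinal.{0}}
    (hs : s ⊆ C (σ + 1) (psi (σ + 1))) {α₀ α : Ordinal.{0}} (hα : α₀ < α)
    (hm : α₀ ∈ Hop σ (params Γ ∪ s)) : psi (hat σ α₀) < psi (hat σ α) :=
  psi_lt_psi (hat_lt_hat σ hα) (C_succ_subset_C_hat σ α (hat_mem_C
    (h.Hop_subset hs (Hop_mono σ subset_union_left h.index_mem)) (h.Hop_subset hs hm)))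

theorem Collapsible.controlled {p : ℕ∞} {α : Ordinal.{0}} (h : Collapsible σ Γ)
    (hc : Controlled p ((Hop σ).relativize (params Γ)) α Γ) :
    Controlled p ((Hop (hat σ α)).relativize (params Γ)) (psi (hat σ α)) Γ := by
  have hα := hc.depth_mem
  have hle : Hop σ (params Γ) ⊆ Hop (hat σ α) (params Γ) :=
    Hop_subset_Hop (lt_hat σ α).le (subset_Hop _ _)
  rw [relativize_empty_apply] at hα
  refine ⟨?_, hc.2⟩
  rw [relativize_empty_apply]
  exact union_subset (singleton_subset_iff.2
    (psi_mem_Hop le_rfl (hat_mem_Hop (hle h.index_mem) (hle hα)))) (subset_Hop _ _)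

/-- The collapsing theorem for derivations of depth `α`. -/
def CollapsesAt (p : ℕ∞) (α : Ordinal.{0}) : Prop :=
  ∀ (σ : Ordinal.{0}) (Γ : Finset (Fml 0 0)), Collapsible σ Γ →
    DerivesLt p (Om + 1) ((Hop σ).relativize (params Γ)) α Γ →
    DerivesLt p (psi (hat σ α)) ((Hop (hat σ α)).relativize (params Γ)) (psi (hat σ α)) Γ

/-- Collapsing a premise `Λ, Δ` of a rule with conclusion `Γ ⊇ Λ`, whose operator may have
received additional parameters `s` occurring in `Δ`. -/
theorem CollapsesAt.premise {p : ℕ∞} {α₀ α : Ordinal.{0}} (ih : CollapsesAt p α₀)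
    (col : Collapsible σ Γ) (hlen : ∀ F ∈ Γ, (F.length : ℕ∞) < p) (hα : α₀ < α)
    {s : Set Ordinal.{0}} (hs : s ⊆ C (σ + 1) (psi (σ + 1))) {Λ Δ : Finset (Fml 0 0)}
    (hΛ : Λ ⊆ Γ) (hsΔ : s ⊆ params Δ) (hΔ : ∀ F ∈ Δ, F.IsS ∨ F.IsB)
    (h : DerivesLt p (Om + 1) (((Hop σ).relativize (params Γ)).relativize s) α₀ (Λ ∪ Δ)) :
    DerivesLt p (psi (hat σ α)) (((Hop (hat σ α)).relativize (params Γ)).relativize s)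
      (psi (hat σ α₀)) (Γ ∪ Δ) := by
  have hc := h.controlled
  have e : ∀ τ : Ordinal.{0}, ((Hop τ).relativize (params Γ)).relativize s ∅ =
      Hop τ (params Γ ∪ s) := fun τ =>
    congrArg (fun X => Hop τ (params Γ ∪ X)) (union_empty s)
  have hα₀ : α₀ ∈ Hop σ (params Γ ∪ s) := e σ ▸ hc.depth_mem
  have hΔp : params Δ ⊆ Hop σ (params Γ ∪ s) :=
    e σ ▸ (params_mono Finset.subset_union_right).trans hc.params_subset
  have hΓp : params Γ ⊆ Hop σ (params Γ ∪ s) := subset_union_left.trans (subset_Hop _ _)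
  have hlen' : ∀ F ∈ Γ ∪ Δ, (F.length : ℕ∞) < p := fun F hF =>
    (Finset.mem_union.1 hF).elim (hlen F) fun hF => hc.2 F (Finset.mem_union_right _ hF)
  have hle : Hop σ (params Γ ∪ s) ⊆ Hop σ (params (Γ ∪ Δ)) :=
    Hop_mono σ (by rw [params_union]; exact union_subset_union_right _ hsΔ)
  have col' : Collapsible σ (Γ ∪ Δ) :=
    { class_mem := fun F hF => (Finset.mem_union.1 hF).elim (col.class_mem F) (hΔ F)
      params_subset := by
        rw [params_union]
        exact union_subset col.params_subset (hΔp.trans (col.Hop_subset hs))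
      index_mem := hle (Hop_mono σ subset_union_left col.index_mem) }
  have h₁ : DerivesLt p (Om + 1) ((Hop σ).relativize (params (Γ ∪ Δ))) α₀ (Γ ∪ Δ) := by
    refine h.weaken le_rfl ((Hop_mono σ).relativize _) (fun X => Hop_mono σ ?_) le_rfl
      ⟨?_, hlen'⟩ (Finset.union_subset_union_left hΛ)
    · rw [← union_assoc, params_union]
      exact union_subset_union_left X (union_subset_union_right _ hsΔ)
    · rw [relativize_empty_apply]
      exact union_subset (singleton_subset_iff.2 (hle hα₀)) (subset_Hop _ _)
  have hle' : ∀ X, Hop σ (params Γ ∪ s) ⊆ Hop (hat σ α) (params Γ ∪ (s ∪ X)) := fun X =>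
    Hop_subset_Hop (lt_hat σ α).le ((union_subset_union_right _ subset_union_left).trans
      (subset_Hop _ _))
  have hκ : hat σ α₀ ≤ hat σ α := (hat_lt_hat σ hα).le
  refine (ih σ _ col' h₁).weaken (psi_mono hκ)
    (((Hop_mono _).relativize _).relativize _) (fun X => Hop_subset_Hop hκ ?_) le_rfl
    ⟨?_, hlen'⟩ subset_rfl
  · rw [params_union]
    exact union_subset (union_subset (hΓp.trans (hle' X)) (hΔp.trans (hle' X)))
      ((subset_union_right.trans subset_union_right).trans (subset_Hop _ _))
  · rw [params_union]
    exact union_subset (singleton_subset_iff.2 (psi_mem_Hop hκ (hat_mem_Hop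
      (hle' ∅ (Hop_mono σ subset_union_left col.index_mem)) (hle' ∅ hα₀))))
      (union_subset (hΓp.trans (hle' ∅)) (hΔp.trans (hle' ∅)))

/-- The case of a premise that is controlled by the same operator as the conclusion. -/
theorem CollapsesAt.premise_of_same {p : ℕ∞} {α₀ α : Ordinal.{0}} (ih : CollapsesAt p α₀)
    (col : Collapsible σ Γ) (hlen : ∀ F ∈ Γ, (F.length : ℕ∞) < p) (hα : α₀ < α)
    {Λ Δ : Finset (Fml 0 0)} (hΛ : Λ ⊆ Γ) (hΔ : ∀ F ∈ Δ, F.IsS ∨ F.IsB)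
    (h : DerivesLt p (Om + 1) ((Hop σ).relativize (params Γ)) α₀ (Λ ∪ Δ)) :
    DerivesLt p (psi (hat σ α)) ((Hop (hat σ α)).relativize (params Γ))
      (psi (hat σ α₀)) (Γ ∪ Δ) ∧ psi (hat σ α₀) < psi (hat σ α) := by
  have hm : α₀ ∈ Hop σ (params Γ ∪ ∅) := h.controlled.depth_mem
  rw [← relativize_empty ((Hop σ).relativize (params Γ))] at h
  have := ih.premise col hlen hα (empty_subset _) hΛ (empty_subset _) hΔ h
  rw [relativize_empty] at this
  exact ⟨this, col.psi_hat_lt (empty_subset _) hα hm⟩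

/-- A cut with a formula of rank `Ω`. The collapsed derivation of `Γ, ∃ x A` has depth
`β = ψ(σ + ω^{Ω+α₀})`, so that boundedness yields `Γ, ∃ x^β A`. The other premise is inverted to
`Γ, ∀ x^β ¬A` and collapsed with the larger index `σ + ω^{Ω+α₀}`, whose operator controls `β`. -/
theorem CollapsesAt.cut_ex {p : ℕ∞} {α₀ α : Ordinal.{0}} (ih : CollapsesAt p α₀)
    (col : Collapsible σ Γ) (hα : α₀ < α) {A : Fml 1 0} (hA : A.IsDelta0)
    (hc : Controlled p ((Hop (hat σ α)).relativize (params Γ)) (psi (hat σ α)) Γ)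
    (h : DerivesLt p (Om + 1) ((Hop σ).relativize (params Γ)) α₀ (Γ ∪ {.ex A}))
    (h' : DerivesLt p (Om + 1) ((Hop σ).relativize (params Γ)) α₀ (Γ ∪ {.all A.neg})) :
    DerivesLt p (psi (hat σ α)) ((Hop (hat σ α)).relativize (params Γ)) (psi (hat σ α)) Γ := by
  have e : ∀ τ : Ordinal.{0}, (Hop τ).relativize (params Γ) ∅ = Hop τ (params Γ) :=
    fun τ => relativize_empty_apply _ _
  have hm : Monotone ((Hop (hat σ α)).relativize (params Γ)) := (Hop_mono _).relativize _
  have hα₀ : α₀ ∈ Hop σ (params Γ) := e σ ▸ h.controlled.depth_mem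
  have hκ : hat σ α₀ ∈ Hop σ (params Γ) := hat_mem_Hop col.index_mem hα₀
  have hκ₁ : hat (hat σ α₀) α₀ ∈ Hop σ (params Γ) := hat_mem_Hop hκ hα₀
  have hle : Hop σ (params Γ) ⊆ Hop (hat σ α) (params Γ) :=
    Hop_subset_Hop (lt_hat σ α).le (subset_Hop _ _)
  have hC : Hop σ (params Γ) ⊆ C (σ + 1) (psi (σ + 1)) := by
    simpa using col.Hop_subset (empty_subset _)
  let β : Level := ⟨psi (hat σ α₀), col.psi_hat_level hα₀⟩
  have hβ : β.1 ∈ Hop (hat σ α) (params Γ) := psi_mem_Hop (hat_lt_hat σ hα).le (hle hκ)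
  obtain ⟨hAp, hAl⟩ := h.controlled.formula (F := .ex A) (by simp)
  replace hAp : A.params ⊆ Hop σ (params Γ) := e σ ▸ hAp
  have hB : (Fml.exL β A).IsB := hA.isD.isB
  have hexp : (Fml.exL β A).params ⊆ Hop (hat σ α) (params Γ) :=
    union_subset (singleton_subset_iff.2 hβ) (hAp.trans hle)
  have hallp : (Fml.allL β A.neg).params = (Fml.exL β A).params := by simp [Fml.params]
  have hall : (((Fml.allL β A.neg).length : ℕ) : ℕ∞) < p := by
    simpa [Fml.length] using hAl
  obtain ⟨hD, hlt⟩ := ih.premise_of_same col hc.2 hα subset_rfl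
    (by simpa using! Or.inl (Fml.IsS.ex (.ofD hA.isD))) h
  have hD' : DerivesLt p (psi (hat σ α)) ((Hop (hat σ α)).relativize (params Γ))
      (psi (hat σ α₀)) (Γ ∪ {.exL β A}) := by
    refine hD.boundedness (β := β) hm (e _ ▸ hβ) le_rfl
      (hc.union subset_rfl (e _ ▸ hβ) fun F hF => ?_) fun F hF => ?_
    · rw [Finset.mem_singleton.1 hF]
      exact ⟨e _ ▸ hexp, hAl⟩
    · rcases Finset.mem_union.1 hF with hF | hF
      · exact .inl (Finset.mem_union_left _ hF)
      · rw [Finset.mem_singleton.1 hF, Fml.atLevel, hA.isD.isB.atLevel_eq]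
        exact .inr ⟨.ex (.ofD hA.isD), by simp⟩
  have hΓ' : params (Γ ∪ {.allL β A.neg}) = params Γ ∪ (Fml.exL β A).params := by
    rw [params_union, ← hallp]; simp [RSStar.params]
  have hlen' : ∀ F ∈ Γ ∪ {Fml.allL β A.neg}, (F.length : ℕ∞) < p := fun F hF =>
    (Finset.mem_union.1 hF).elim (hc.2 F) fun hF => Finset.mem_singleton.1 hF ▸ hall
  have hsub : Hop σ (params Γ) ⊆ Hop (hat σ α₀) (params (Γ ∪ {.allL β A.neg})) :=
    Hop_subset_Hop (lt_hat _ _).le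
      ((params_mono Finset.subset_union_left).trans (subset_Hop _ _))
  have col' : Collapsible (hat σ α₀) (Γ ∪ {.allL β A.neg}) :=
    { class_mem := fun F hF => (Finset.mem_union.1 hF).elim (col.class_mem F) fun hF =>
        .inr (Finset.mem_singleton.1 hF ▸ hA.neg.isD.isB)
      params_subset := by
        have hC' : C (σ + 1) (psi (σ + 1)) ⊆ C (hat σ α₀ + 1) (psi (hat σ α₀ + 1)) :=
          (C_succ_subset_C_hat σ α₀).trans
            (C_mono le_self_add (psi_mono le_self_add))
        rw [hΓ']
        exact union_subset (col.params_subset.trans hC') (union_subset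
          (singleton_subset_iff.2 (psi_mem_C (lt_add_one _) (hC' (hC hκ))))
          ((hAp.trans hC).trans hC'))
      index_mem := hsub hκ }
  have hE : DerivesLt p (Om + 1)
      ((Hop (hat σ α₀)).relativize (params (Γ ∪ {.allL β A.neg}))) α₀
      (Γ ∪ {.allL β A.neg}) := by
    refine h'.weaken_all β le_rfl ((Hop_mono _).relativize _) (fun X =>
      Hop_subset_Hop (lt_hat _ _).le ((union_subset_union_left X
        (params_mono Finset.subset_union_left)).trans (subset_Hop _ _))) le_rfl
      ⟨?_, hlen'⟩ fun F hF => ?_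
    · rw [relativize_empty_apply]
      exact union_subset (singleton_subset_iff.2 (hsub hα₀)) (subset_Hop _ _)
    · rcases Finset.mem_union.1 hF with hF | hF
      · exact .inl (Finset.mem_union_left _ hF)
      · exact .inr ⟨A.neg, Finset.mem_singleton.1 hF, by simp⟩
  have hκ₁le : hat (hat σ α₀) α₀ < hat σ α := hat_hat_lt_hat σ hα
  have hE' := (ih _ _ col' hE).weaken (psi_mono hκ₁le.le) hm (fun X => Hop_subset_Hop hκ₁le.le
    (by
      have hX : Hop (hat σ α) (params Γ) ⊆ Hop (hat σ α) (params Γ ∪ X) :=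
        Hop_mono _ subset_union_left
      rw [hΓ']
      exact union_subset (union_subset ((subset_Hop _ _).trans hX) (hexp.trans hX))
        (subset_union_right.trans (subset_Hop _ _)))) le_rfl
    (⟨by
      rw [hΓ', e]
      exact union_subset (singleton_subset_iff.2 (psi_mem_Hop hκ₁le.le (hle hκ₁)))
        (union_subset (subset_Hop _ _) hexp), hlen'⟩) subset_rfl
  refine .cut (F := .exL β A)
    (psi_lt_psi hκ₁le (C_succ_subset_C_hat σ α (hC hκ₁))) (hB.rank_lt_psi ?_) hAl
    (hD'.weaken le_rfl hm le_rfl (psi_mono (lt_hat _ _).le)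
      ⟨union_subset (singleton_subset_iff.2 hE'.controlled.depth_mem)
        hD'.controlled.params_subset, hD'.controlled.2⟩ subset_rfl) hE' hc
  exact union_subset (singleton_subset_iff.2 hlt)
    fun ξ hξ => lt_psi_hat (hC (hAp hξ)) (A.params_subset_level hξ).1 α

/-- Reflection is replaced by the rule `BC` for the level `β = ψ(σ + ω^{Ω+α₀})` obtained from
boundedness, whose conclusion `∃ z^{β+ω} F^{(z)}` implies `∃ z F^{(z)}`. -/
theorem CollapsesAt.reflection {p : ℕ∞} {α₀ α : Ordinal.{0}} (ih : CollapsesAt p α₀)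
    (col : Collapsible σ Γ) (hα : α₀ < α) {F : Fml 0 0} (hF : F.IsS0)
    (hP : .ex (F.wk.restrict (.bound 0)) ∈ Γ) {Λ : Finset (Fml 0 0)} (hΛ : Λ ⊆ Γ)
    (hc : Controlled p ((Hop (hat σ α)).relativize (params Γ)) (psi (hat σ α)) Γ)
    (h : DerivesLt p (Om + 1) ((Hop σ).relativize (params Γ)) α₀ (Λ ∪ {F})) :
    DerivesLt p (psi (hat σ α)) ((Hop (hat σ α)).relativize (params Γ)) (psi (hat σ α)) Γ := by
  have e : ∀ τ : Ordinal.{0}, (Hop τ).relativize (params Γ) ∅ = Hop τ (params Γ) :=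
    fun τ => relativize_empty_apply _ _
  have hm : Monotone ((Hop (hat σ α)).relativize (params Γ)) := (Hop_mono _).relativize _
  have hα₀ : α₀ ∈ Hop σ (params Γ) := e σ ▸ h.controlled.depth_mem
  have hκ : hat σ α₀ ∈ Hop σ (params Γ) := hat_mem_Hop col.index_mem hα₀
  have hle : Hop σ (params Γ) ⊆ Hop (hat σ α) (params Γ) :=
    Hop_subset_Hop (lt_hat σ α).le (subset_Hop _ _)
  let β : Level := ⟨psi (hat σ α₀), col.psi_hat_level hα₀⟩
  have hβ : β.1 ∈ Hop (hat σ α) (params Γ) := psi_mem_Hop (hat_lt_hat σ hα).le (hle hκ)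
  obtain ⟨hPp, hPl⟩ := hc.formula hP
  have hB := (F.wk).isB_restrict (.bound 0)
  set B := F.wk.restrict (.bound 0) with hBdef
  replace hPp : B.params ⊆ Hop (hat σ α) (params Γ) := e _ ▸ hPp
  obtain ⟨hD, hlt⟩ := ih.premise_of_same col hc.2 hα hΛ
    (by simpa using! Or.inl hF.1.isS) h
  obtain ⟨hFp, hFl⟩ := hD.controlled.formula (F := F) (by simp)
  replace hFp : (F.atLevel β).params ⊆ (Hop (hat σ α)).relativize (params Γ) ∅ :=
    (F.params_atLevel β).trans (union_subset (singleton_subset_iff.2 (e _ ▸ hβ)) hFp)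
  replace hFl : (((F.atLevel β).length : ℕ) : ℕ∞) < p := by simpa using hFl
  let τ : Level := β.add Level.omega
  have hτ : τ.1 ∈ Hop (hat σ α) (params Γ) := add_mem_Hop hβ (omega0_mem_Hop _ _)
  have hτlt : τ.1 < psi (hat σ α) := add_lt_psi hlt (omega0_lt_psi _)
  have hex : (Fml.exL τ B).params ⊆ Hop (hat σ α) (params Γ) :=
    union_subset (singleton_subset_iff.2 hτ) hPp
  have hcex : Controlled p ((Hop (hat σ α)).relativize (params Γ)) (β.1 + 1)
      (Γ ∪ {.exL τ B}) :=
    hc.union subset_rfl (e _ ▸ add_mem_Hop hβ (one_mem_Hop _ _)) fun G hG => by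
      rw [Finset.mem_singleton.1 hG]
      exact ⟨e _ ▸ hex, hPl⟩
  have hD' : DerivesLt p (psi (hat σ α)) ((Hop (hat σ α)).relativize (params Γ)) β.1
      (Γ ∪ {.exL τ B} ∪ {F.atLevel β}) := by
    refine hD.boundedness (β := β) hm (e _ ▸ hβ) le_rfl
      (hcex.union subset_rfl (e _ ▸ hβ) fun G hG => ?_) fun G hG => ?_
    · rw [Finset.mem_singleton.1 hG]
      exact ⟨hFp, hFl⟩
    · rcases Finset.mem_union.1 hG with hG | hG
      · exact .inl (by simp [hG])
      · rw [Finset.mem_singleton.1 hG]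
        exact .inr ⟨hF.1.isS, by simp⟩
  have hbc := hD'.bc' (Finset.mem_union_right _ (Finset.mem_singleton_self _))
    (lt_add_one β.1) hF hcex
  have hτ₁ : β.1 + 1 ≤ τ.1 := by
    change β.1 + 1 ≤ β.1 + ω
    gcongr
    exact one_lt_omega0.le
  have hBC : (Fml.exL τ B).IsB := hB
  have hΓlt : B.params ⊆ Iio (psi (hat σ α)) := fun ξ hξ =>
    have hξ' := Fml.params_subset_params hP hξ
    lt_psi_hat (col.params_subset hξ') (params_subset_level Γ hξ').1 α
  exact hbc.ex_of_exL hB ((zero_le (a := β.1)).trans_lt ((lt_add_one _).trans_le hτ₁)) hP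
    (hBC.rank_lt_psi (union_subset (singleton_subset_iff.2 hτlt) hΓlt))
    (hτ₁.trans (le_self_add.trans (le_self_add.trans le_self_add)))
    (add_one_lt_psi (add_one_lt_psi (add_one_lt_psi hτlt))) hc

/-- Collapsing at every depth: the rules other than reflection and the cuts of rank `Ω` are applied
to the collapsed premises. -/
theorem collapsesAt (p : ℕ∞) (α : Ordinal.{0}) : CollapsesAt p α := by
  induction α using WellFoundedLT.induction with
  | ind α ih =>
  intro σ Γ col h
  have hc := col.controlled h.controlled
  have hlen := h.controlled.2
  have hC : Hop σ (params Γ ∪ ∅) ⊆ C (σ + 1) (psi (σ + 1)) := col.Hop_subset (empty_subset _)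
  -- A level bounded by a parameter of `Γ` lies below `ψ(σ + 1)`.
  have below : ∀ {ξ ζ : Ordinal.{0}}, ξ ≤ ζ → ζ ∈ params Γ →
      ({ξ} : Set Ordinal.{0}) ⊆ C (σ + 1) (psi (σ + 1)) := fun hξ hζ =>
    singleton_subset_iff.2 (Closure.base (hξ.trans_lt
      (lt_psi_of_mem (col.params_subset hζ) (params_subset_level Γ hζ).1)))
  have depth_lt : ∀ {β : Level} {α₀ : Ordinal.{0}} {Θ : Finset (Fml 0 0)},
      ({β.1} : Set Ordinal.{0}) ⊆ C (σ + 1) (psi (σ + 1)) → α₀ < α →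
      DerivesLt p (Om + 1) (((Hop σ).relativize (params Γ)).relativize {β.1}) α₀ Θ →
      psi (hat σ α₀) < psi (hat σ α) := by
    intro β α₀ Θ hβ hα h
    have := h.controlled.depth_mem
    rw [relativize_empty_apply] at this
    exact col.psi_hat_lt hβ hα this
  suffices key : ∀ Θ H, Θ = Γ → H = (Hop σ).relativize (params Γ) →
      DerivesLt p (Om + 1) H α Θ → DerivesLt p (psi (hat σ α))
        ((Hop (hat σ α)).relativize (params Γ)) (psi (hat σ α)) Γ from key _ _ rfl rfl h
  intro Θ H hΘ hH h
  have context : ∀ {Λ : Finset (Fml 0 0)} {P : Fml 0 0}, Λ ∪ {P} = Γ → P ∈ Γ ∧ Λ ⊆ Γ := by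
    rintro Λ P rfl
    exact ⟨by simp, Finset.subset_union_left⟩
  cases h with
  | ax hax _ => exact .ax (hΘ ▸ hax) hc
  | @or _ _ α₀ Λ F G hlt h _ =>
    subst hH
    obtain ⟨hP, hΛ⟩ := context hΘ
    obtain ⟨h, hlt⟩ := (ih _ hlt).premise_of_same col hlen hlt hΛ (by
      rcases col.class_mem _ hP with h | h
      · simp [h.of_or]
      · simp [h.1, h.2]) h
    exact h.or' hP hlt hc
  | @and _ _ α₀ α₁ Λ F G hlt hlt' h h' _ =>
    subst hH
    obtain ⟨hP, hΛ⟩ := context hΘ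
    have hFG : (F.IsS ∨ F.IsB) ∧ (G.IsS ∨ G.IsB) := by
      rcases col.class_mem _ hP with h | h
      · simp [h.of_and]
      · simp [h.1, h.2]
    obtain ⟨h, hlt⟩ := (ih _ hlt).premise_of_same col hlen hlt hΛ (by simp [hFG]) h
    obtain ⟨h', hlt'⟩ := (ih _ hlt').premise_of_same col hlen hlt' hΛ (by simp [hFG]) h'
    exact DerivesLt.and' hP hlt hlt' h h' hc
  | @nlev _ _ Λ l a d hl hd h _ =>
    subst hH
    obtain ⟨hP, hΛ⟩ := context hΘ
    have hs : ∀ β : Level, β < l → ({β.1} : Set Ordinal.{0}) ⊆ C (σ + 1) (psi (σ + 1)) :=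
      fun β hβ => below hβ.le (Fml.params_subset_params hP rfl)
    exact DerivesLt.nlev' hP (fun β => psi (hat σ (d β))) hl
      (fun β hβ => depth_lt (hs β hβ) (hd β hβ) (h β hβ))
      (fun β hβ => (ih _ (hd β hβ)).premise col hlen (hd β hβ) (hs β hβ) hΛ
        (by simp [params, Fml.params]) (by simp [Fml.IsB]) (h β hβ)) hc
  | @ex _ _ α₀ Λ F β a hlt hβ h _ =>
    subst hH
    obtain ⟨hP, hΛ⟩ := context hΘ
    have hF : F.IsS := (col.class_mem _ hP).elim Fml.IsS.of_ex fun h => absurd h id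
    have hβ' : β.1 < psi (hat σ α) := lt_psi_hat (hC ((h.controlled.formula
      (F := .and (.lev β a) (F.inst a)) (by simp)).1 (.inl rfl))) β.2.1 α
    obtain ⟨h, hlt⟩ := (ih _ hlt).premise_of_same col hlen hlt hΛ
      (by simpa using! Or.inl (Fml.IsS.and (.ofD (m := 0) (F := .lev β a) trivial) (hF.subst _))) h
    exact h.ex' hP hlt hβ' hc
  | all =>
    exact absurd (col.class_mem _ (context hΘ).1) (not_or.2 ⟨Fml.not_isS_all, id⟩)
  | @exL _ _ α₀ Λ τ F β a hlt hβ h _ =>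
    subst hH
    obtain ⟨hP, hΛ⟩ := context hΘ
    obtain ⟨h, hlt⟩ := (ih _ hlt).premise_of_same col hlen hlt hΛ (by
      simpa using! (col.class_mem _ hP).imp
        (fun h => Fml.IsS.and (.ofD (m := 0) (F := .lev β a) trivial) (h.of_exL.subst _))
        (fun h : F.IsB => (⟨trivial, h.subst _⟩ : (Fml.and (.lev β a) (F.inst a)).IsB))) h
    exact h.exL' hP hlt hβ hc
  | @allL _ _ Λ τ F d hd h _ =>
    subst hH
    obtain ⟨hP, hΛ⟩ := context hΘ
    have hs : ∀ β : Level, β ≤ τ → ({β.1} : Set Ordinal.{0}) ⊆ C (σ + 1) (psi (σ + 1)) :=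
      fun β hβ => below hβ (Fml.params_subset_params hP (.inl rfl))
    exact DerivesLt.allL' hP (fun β => psi (hat σ (d β)))
      (fun β hβ => depth_lt (hs β hβ) (hd β hβ) (h β .empty hβ))
      (fun β a hβ => (ih _ (hd β hβ)).premise col hlen (hd β hβ) (hs β hβ) hΛ
        (by simp [params, Fml.params]) (by
          simpa using! (col.class_mem _ hP).imp
            (fun h => Fml.IsS.or (.ofD (m := 0) (F := .nlev β a) trivial) (h.of_allL.subst _))
            (fun h : F.IsB => (⟨trivial, h.subst _⟩ : (Fml.or (.nlev β a) (F.inst a)).IsB)))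
        (h β a hβ)) hc
  | @bex _ _ α₀ Λ a F b hlt h _ =>
    subst hH
    obtain ⟨hP, hΛ⟩ := context hΘ
    obtain ⟨h, hlt⟩ := (ih _ hlt).premise_of_same col hlen hlt hΛ (by
      simpa using! (col.class_mem _ hP).imp
        (fun h => Fml.IsS.and (.ofD (m := 0) (F := .mem b a) trivial) (h.of_bex.subst _))
        (fun h : F.IsB => (⟨trivial, h.subst _⟩ : (Fml.and (.mem b a) (F.inst b)).IsB))) h
    exact h.bex' hP hlt hc
  | @ball _ _ α₀ Λ a F hlt h _ =>
    subst hH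
    obtain ⟨hP, hΛ⟩ := context hΘ
    have h' := fun b => (ih _ hlt).premise_of_same col hlen hlt hΛ (by
      simpa using! (col.class_mem _ hP).imp
        (fun h => Fml.IsS.or (.ofD (m := 0) (F := .nmem b a) trivial) (h.of_ball.subst _))
        (fun h : F.IsB => (⟨trivial, h.subst _⟩ : (Fml.or (.nmem b a) (F.inst b)).IsB))) (h b)
    exact DerivesLt.ball' hP (h' .empty).2 (fun b => (h' b).1) hc
  | @exR _ _ α₀ Λ F U hlt h _ =>
    subst hH
    obtain ⟨hP, hΛ⟩ := context hΘ
    have hF : F.IsB := (col.class_mem _ hP).resolve_left Fml.not_isS_exR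
    obtain ⟨h, hlt⟩ := (ih _ hlt).premise_of_same col hlen hlt hΛ
      (by simpa using! Or.inr (hF.substR _)) h
    exact h.exR' hP hlt hc
  | @allR _ _ α₀ Λ F hlt h _ =>
    subst hH
    obtain ⟨hP, hΛ⟩ := context hΘ
    have hF : F.IsB := (col.class_mem _ hP).resolve_left Fml.not_isS_allR
    have h' := fun U => (ih _ hlt).premise_of_same col hlen hlt hΛ
      (by simpa using! Or.inr (hF.substR _)) (h U)
    exact DerivesLt.allR' hP (h' (.free 0)).2 (fun U => (h' U).1) hc
  | @cut _ _ α₀ _ F hlt hr hl h h' _ =>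
    subst hH hΘ
    rcases (Order.lt_add_one_iff.1 hr).lt_or_eq with hr | hr
    · have hF := Fml.isB_of_rank_lt hr
      have hFp : F.params ⊆ Iio (psi (hat σ α)) := fun ξ hξ =>
        lt_psi_hat (hC ((h.controlled.formula (F := F) (by simp)).1 hξ))
          (F.params_subset_level hξ).1 α
      obtain ⟨h, hlt'⟩ := (ih _ hlt).premise_of_same col hlen hlt subset_rfl
        (by simpa using! Or.inr hF) h
      obtain ⟨h', -⟩ := (ih _ hlt).premise_of_same col hlen hlt subset_rfl
        (by simpa using! Or.inr hF.neg) h'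
      exact .cut hlt' (hF.rank_lt_psi hFp) hl h h' hc
    · obtain ⟨A, hA, rfl | rfl⟩ := Fml.eq_of_rank_eq_Om hr
      · exact (ih _ hlt).cut_ex col hlt hA hc h h'
      · exact (ih _ hlt).cut_ex col hlt hA.neg hc h' (by rwa [Fml.neg_neg])
  | @ref _ _ α₀ Λ F hlt hΩ hF h _ =>
    subst hH
    obtain ⟨hP, hΛ⟩ := context hΘ
    exact (ih _ hlt).reflection col hlt hF hP hΛ hc h
  | @bc _ _ α₀ Λ F β hlt hF h _ =>
    subst hH
    obtain ⟨hP, hΛ⟩ := context hΘ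
    obtain ⟨h, hlt⟩ := (ih _ hlt).premise_of_same col hlen hlt hΛ
      (by simpa using! Or.inr (hF.1.isS.isB_atLevel β)) h
    exact h.bc' hP hlt hF hc

end RSStar

open RSStar
theorem mainTheorem4 (Γ : Finset (Fml 0 0)) (hΓ : ∀ F ∈ Γ, F.IsS ∨ F.IsB)
    (σ : Ordinal.{0}) (hC : RSStar.params Γ ⊆ RSStar.C (σ + 1) (psi (σ + 1)))
    (hσ : σ ∈ (Hop σ).relativize (RSStar.params Γ) ∅) :
    (∀ α : Ordinal.{0},
      Derives (Om + 1) ((Hop σ).relativize (RSStar.params Γ)) α Γ →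
      Derives (psi (hat σ α)) ((Hop (hat σ α)).relativize (RSStar.params Γ)) (psi (hat σ α)) Γ) ∧
    (∀ (α : Ordinal.{0}) (p : ℕ),
      DerivesLt p (Om + 1) ((Hop σ).relativize (RSStar.params Γ)) α Γ →
      DerivesLt p (psi (hat σ α)) ((Hop (hat σ α)).relativize (RSStar.params Γ))
        (psi (hat σ α)) Γ) := by
  have col : Collapsible σ Γ := ⟨hΓ, hC, relativize_empty_apply (Hop σ) _ ▸ hσ⟩
  exact ⟨fun α => collapsesAt ⊤ α σ Γ col, fun α p => collapsesAt p α σ Γ col⟩
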